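/- Let $F$ be a field of characteristic different from two; a form over $F$ is a regular finite-dimensional quadratic form. Write $n\times q$ for the orthogonal sum of $n$ copies of $q$, and $\langle a_1,\dots,a_n\rangle$ for the form $a_1X_1^2+\dots+a_nX_n^2$. A Pfister form is a form isometric to $\langle 1,a_1\rangle\otimes\cdots\otimes\langle 1,a_n\rangle$ for some $n\ge 0$ and $a_1,\dots,a_n\in F^\times$ (it is $\langle 1\rangle$ for $n=0$). For a form $q$ over $F$ and a field extension $K/F$, the $q$-level $s_q(K)\in\{1,2,\dots\}\cup\{\infty\}$ is the least positive integer $n$ such that $(n\times q)_K$ represents $-1$ over $K$, and is $\infty$ if there is none. The $q$-length $\ell_q(\psi)\in\{0,1,2,\dots\}\cup\{\infty\}$ of a form $\psi$ over $F$ is the least $n$ such that $\psi\subset n\times q$, that is, $n\times q\simeq\psi\perp r$ for some form $r$, and is $\infty$ if there is none. For a form $\varphi$ over $F$, $D_F(\varphi)$ is the set of its nonzero values, and for $\varphi$ anisotropic of dimension $n\ge 2$, $F(\varphi)$ is the quotient field of the integral domain $F[X_1,\dots,X_n]/(\varphi(X_1,\dots,X_n))$. Proposition. Let $q$ be an anisotropic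 Pfister form over $F$ and let $\varphi$ be an anisotropic form over $F$ with $\dim\varphi\ge 2$ and $\dim\varphi\le s_q(F)\cdot\dim q$. Then, for every $a\in D_F(\varphi)$, $$s_q(F(\varphi))\le \ell_q(a\varphi)\le 2\,s_q(F(\varphi)).$$ -/

import Mathlib

open scoped TensorProduct

noncomputable section

namespace QForm

universe u v w

section CommRing

variable {R : Type u} [CommRing R] {V : Type v} [AddCommGroup V] [Module R V]

/-- The orthogonal sum `n × q` of `n` copies of `q`. -/
abbrev copies (n : ℕ) (q : QuadraticForm R V) : QuadraticForm R (Fin n → V) :=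
  QuadraticMap.pi fun _ : Fin n => q

/-- The set `D(φ)` of nonzero values of `φ`. -/
def values (φ : QuadraticForm R V) : Set R := {a | a ≠ 0 ∧ ∃ v, φ v = a}

/-- The `q`-level: the least positive integer `n` such that `n × q` represents `-1`, and `⊤` if
there is none. -/
def level (q : QuadraticForm R V) : ℕ∞ :=
  sInf {N : ℕ∞ | ∃ n : ℕ, N = n ∧ 0 < n ∧ ∃ v, copies n q v = -1}

end CommRing

section Field

variable {F : Type u} [Field F] {V : Type v} [AddCommGroup V] [Module F V]
  {W : Type w} [AddCommGroup W] [Module F W]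

/-- `p ⊂ q`: there is a regular form `r` with `q ≃ p ⊥ r`. Every regular form is isometric to one
on some `F ^ m`, so that it is enough to let `r` range over these. -/
def IsSubform (p : QuadraticForm F W) (q : QuadraticForm F V) : Prop :=
  ∃ (m : ℕ) (r : QuadraticForm F (Fin m → F)), r.Nondegenerate ∧ q.Equivalent (p.prod r)

/-- The `q`-length of `φ`: the least natural number `n` with `φ ⊂ n × q`, and `⊤` if there is
none. -/
def length (q : QuadraticForm F V) (φ : QuadraticForm F W) : ℕ∞ :=
  sInf {N : ℕ∞ | ∃ n : ℕ, N = n ∧ IsSubform φ (copies n q)}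

/-- The binary form `⟨1, a⟩`. -/
def binary (a : Fˣ) : QuadraticForm F (Fin 2 → F) :=
  QuadraticMap.weightedSumSquares F ![(1 : F), (a : F)]

theorem exists_linear {n : ℕ} {g : MvPolynomial (Fin n) F} (hg : g.IsHomogeneous 1) :
    ∃ L : (Fin n → F) →ₗ[F] F, ∀ x, MvPolynomial.eval x g = L x := by
  have hg' : g ∈ MvPolynomial.homogeneousSubmodule (Fin n) F 1 := hg
  rw [MvPolynomial.homogeneousSubmodule_one_eq_span_X] at hg'
  induction hg' using Submodule.span_induction with
  | mem x h =>
    obtain ⟨i, rfl⟩ := h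
    exact ⟨LinearMap.proj i, fun x => by simp⟩
  | zero => exact ⟨0, fun x => by simp⟩
  | add a b ha hb iha ihb =>
    rw [← MvPolynomial.homogeneousSubmodule_one_eq_span_X] at ha hb
    obtain ⟨L, hL⟩ := iha ha
    obtain ⟨M, hM⟩ := ihb hb
    exact ⟨L + M, fun x => by simp [hL, hM]⟩
  | smul c a ha iha =>
    rw [← MvPolynomial.homogeneousSubmodule_one_eq_span_X] at ha
    obtain ⟨L, hL⟩ := iha ha
    exact ⟨c • L, fun x => by simp [hL]⟩

variable [Invertible (2 : F)]

/-- The form `⟨1, a₁⟩ ⊗ ⋯ ⊗ ⟨1, aₙ⟩`, on the tensor product of the underlying spaces; it is `⟨1⟩`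
for the empty list. -/
def pfister : List Fˣ → QuadraticModuleCat.{u} F
  | [] => QuadraticModuleCat.of (QuadraticMap.sq : QuadraticForm F F)
  | a :: l => QuadraticModuleCat.of (QuadraticForm.tmul (binary a) (pfister l).form)

/-- `q` is an `n`-fold Pfister form for some `n ≥ 0`. -/
def IsPfister (q : QuadraticForm F V) : Prop :=
  ∃ l : List Fˣ, q.Equivalent (pfister l).form

section FunctionField

variable [Module.Finite F V]

/-- The homogeneous quadratic polynomial `φ(X₁, …, Xₙ)` of `φ` in a basis of the space. -/
def poly (φ : QuadraticForm F V) : MvPolynomial (Fin (Module.finrank F V)) F :=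
  ∑ i, ∑ j, MvPolynomial.C (QuadraticMap.associated (R := F) φ
      (Module.finBasis F V i) (Module.finBasis F V j)) * (MvPolynomial.X i * MvPolynomial.X j)

/-- The coordinate ring `F[X₁, …, Xₙ] / (φ(X₁, …, Xₙ))`. -/
abbrev CoordRing (φ : QuadraticForm F V) : Type u :=
  MvPolynomial (Fin (Module.finrank F V)) F ⧸ Ideal.span {poly φ}

/-- The function field `F(φ)`: the quotient field of `F[X₁, …, Xₙ] / (φ(X₁, …, Xₙ))`, for forms
for which this ring is an integral domain. -/
abbrev FunctionField (φ : QuadraticForm F V) : Type u := FractionRing (CoordRing φ)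

theorem eval_poly (φ : QuadraticForm F V) (x : Fin (Module.finrank F V) → F) :
    MvPolynomial.eval x (poly φ) = φ (∑ i, x i • Module.finBasis F V i) := by
  rw [← QuadraticMap.associated_eq_self_apply F φ]
  simp only [poly, map_sum, map_mul, MvPolynomial.eval_C, MvPolynomial.eval_X,
    LinearMap.sum_apply, map_smul, LinearMap.smul_apply, smul_eq_mul, Finset.mul_sum]
  rw [Finset.sum_comm]
  exact Finset.sum_congr rfl fun i _ => Finset.sum_congr rfl fun j _ => by ring

theorem isHomogeneous_poly (φ : QuadraticForm F V) : (poly φ).IsHomogeneous 2 := by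
  refine MvPolynomial.IsHomogeneous.sum _ _ _ fun i _ =>
    MvPolynomial.IsHomogeneous.sum _ _ _ fun j _ => MvPolynomial.IsHomogeneous.C_mul ?_ _
  exact (MvPolynomial.isHomogeneous_X F i).mul (MvPolynomial.isHomogeneous_X F j)

theorem irreducible_poly {φ : QuadraticForm F V} (hφ : φ.Anisotropic)
    (hdim : 2 ≤ Module.finrank F V) : Irreducible (poly φ) := by
  have aniso : ∀ x : Fin (Module.finrank F V) → F,
      MvPolynomial.eval x (poly φ) = 0 → x = 0 := by
    intro x hx
    rw [eval_poly] at hx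
    have h := hφ _ hx
    funext i
    exact Fintype.linearIndependent_iff.1 (Module.finBasis F V).linearIndependent x h i
  have h0 : poly φ ≠ 0 := by
    intro h
    have := congrFun (aniso (fun _ => 1) (by simp [h])) ⟨0, by omega⟩
    simp at this
  have hdeg : (poly φ).totalDegree = 2 := (isHomogeneous_poly φ).totalDegree h0
  refine ⟨fun hu => ?_, fun g h hgh => ?_⟩
  · have := (MvPolynomial.isUnit_iff_totalDegree_of_isReduced.mp hu).2
    omega
  have hg0 : g ≠ 0 := by rintro rfl; simp at hgh; exact h0 hgh
  have hh0 : h ≠ 0 := by rintro rfl; simp at hgh; exact h0 hgh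
  have hsum : g.totalDegree + h.totalDegree = 2 := by
    rw [← MvPolynomial.totalDegree_mul_of_isDomain hg0 hh0, ← hgh, hdeg]
  have key : ∀ p : MvPolynomial (Fin (Module.finrank F V)) F, p ≠ 0 → p.totalDegree = 0 →
      IsUnit p := by
    intro p hp hp0
    rw [MvPolynomial.totalDegree_eq_zero_iff_eq_C] at hp0
    rw [hp0]
    refine IsUnit.map _ (isUnit_iff_ne_zero.2 fun hc => hp ?_)
    rw [hp0, hc, map_zero]
  by_cases hgd : g.totalDegree = 0
  · exact Or.inl (key g hg0 hgd)
  by_cases hhd : h.totalDegree = 0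
  · exact Or.inr (key h hh0 hhd)
  exfalso
  have split : ∀ p : MvPolynomial (Fin (Module.finrank F V)) F, p.totalDegree = 1 →
      p = MvPolynomial.homogeneousComponent 0 p + MvPolynomial.homogeneousComponent 1 p := by
    intro p hp
    have := MvPolynomial.sum_homogeneousComponent p
    rw [hp, Finset.sum_range_succ, Finset.sum_range_one] at this
    exact this.symm
  have hg1 := split g (by omega)
  have hh1 := split h (by omega)
  have g0h := MvPolynomial.homogeneousComponent_isHomogeneous 0 g
  have g1h := MvPolynomial.homogeneousComponent_isHomogeneous 1 g
  have h0h := MvPolynomial.homogeneousComponent_isHomogeneous 0 h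
  have h1h := MvPolynomial.homogeneousComponent_isHomogeneous 1 h
  set g0 := MvPolynomial.homogeneousComponent 0 g
  set g1 := MvPolynomial.homogeneousComponent 1 g
  set k0 := MvPolynomial.homogeneousComponent 0 h
  set k1 := MvPolynomial.homogeneousComponent 1 h
  have hP : poly φ = g1 * k1 := by
    have e : poly φ = g0 * k0 + g0 * k1 + g1 * k0 + g1 * k1 := by
      rw [hgh, hg1, hh1]; ring
    have e2 := congrArg (MvPolynomial.homogeneousComponent 2) e
    simp only [map_add] at e2
    rw [MvPolynomial.homogeneousComponent_of_mem (isHomogeneous_poly φ),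
      MvPolynomial.homogeneousComponent_of_mem (g0h.mul h0h),
      MvPolynomial.homogeneousComponent_of_mem (g0h.mul h1h),
      MvPolynomial.homogeneousComponent_of_mem (g1h.mul h0h),
      MvPolynomial.homogeneousComponent_of_mem (g1h.mul h1h)] at e2
    simpa using e2
  obtain ⟨L, hL⟩ := exists_linear g1h
  have hker : LinearMap.ker L ≠ ⊥ := LinearMap.ker_ne_bot_of_finrank_lt (by simp; omega)
  obtain ⟨x, hx, hx0⟩ := Submodule.exists_mem_ne_zero_of_ne_bot hker
  apply hx0
  apply aniso
  rw [hP, map_mul, hL, LinearMap.mem_ker.1 hx, zero_mul]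

/-- For an anisotropic form of dimension at least two, `F[X₁, …, Xₙ] / (φ(X₁, …, Xₙ))` is an
integral domain. -/
theorem isDomain_coordRing {φ : QuadraticForm F V} (hφ : φ.Anisotropic)
    (hdim : 2 ≤ Module.finrank F V) : IsDomain (CoordRing φ) := by
  have hirr := irreducible_poly hφ hdim
  have : (Ideal.span {poly φ}).IsPrime :=
    (Ideal.span_singleton_prime hirr.ne_zero).2 hirr.prime
  exact Ideal.Quotient.isDomain _

/-- For an anisotropic form of dimension at least two, `F(φ)` is a field. -/
theorem isField_functionField {φ : QuadraticForm F V} (hφ : φ.Anisotropic)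
    (hdim : 2 ≤ Module.finrank F V) : IsField (FunctionField φ) := by
  have := isDomain_coordRing hφ hdim
  exact Field.toIsField (FractionRing (CoordRing φ))

end FunctionField

end Field

end QForm

end

/-! Write K = F(φ). For the lower bound, suppose aφ ⊂ n×q. The generic zero of φ makes n×q isotropic
over K. The Pfister form q is multiplicative over K (each value is the factor of a self-similarity)
and takes every value once it is isotropic, so dividing an isotropy relation by one of its nonzero
terms exhibits -1 as a value of n×q (`IsMultiplicative.exists_copies_eq_neg_one`).

For the upper bound, let m be the level over K, 2^k ≤ m < 2^(k+1), and π = 2^(k+1)×q, which is again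
multiplicative over every extension. Since m×q represents -1 over K, π is isotropic over K. As
2^(k+1) ≤ 2m, it suffices to embed aφ in π.

If π is isotropic over F, then P = 2^k×q represents -1, so π ≃ P ⊥ -P receives every form of
dimension at most dim P. Moreover the level of q over F is at most 2^k, so the hypothesis on dim φ
gives dim φ ≤ dim P.

If π is anisotropic over F, an isotropic vector over K lifts to polynomials f with φ(X) ∣ π(f), not
all divisible by φ(X). Diagonalise φ(X) as α₀(X₀² + d) and reduce modulo X₀² + d: the remainders w
are linear in X₀, so π(w) = (X₀² + d)π(v) with v free of X₀. By multiplicativity π represents α₀φ(X)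
over F(X), and the Cassels-Pfister subform theorem (`AnisotropicOn.subform`) embeds α₀φ in π. A
similarity of π then trades α₀ for a.

The linear equations `S` in `AnisotropicOn` encode orthogonal complements: the induction for the
subform theorem adds an equation and keeps the diagonal form unchanged. -/

noncomputable section

namespace QForm

universe u

/-! ### Diagonal forms over polynomial rings, and the Cassels-Pfister theorems. -/

section Diagonal

variable {F : Type*} [Field F] {ι : Type*} [Fintype ι]
  {R : Type*} [CommRing R] [Algebra F R] {R' : Type*} [CommRing R'] [Algebra F R']

/-- The diagonal bilinear form `∑ cᵢ xᵢ yᵢ` with weights in `F` over an `F`-algebra. -/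
def diag (c : ι → F) (x y : ι → R) : R := ∑ i, c i • (x i * y i)

theorem weightedSumSquares_eq_diag (c : ι → F) (x : ι → R) :
    QuadraticMap.weightedSumSquares R c x = diag c x x := by
  simp [diag, QuadraticMap.weightedSumSquares_apply]

theorem diag_comm (c : ι → F) (x y : ι → R) : diag c x y = diag c y x := by
  simp only [diag, mul_comm]

theorem diag_add_left (c : ι → F) (x y z : ι → R) :
    diag c (x + y) z = diag c x z + diag c y z := by
  simp [diag, add_mul, Finset.sum_add_distrib]

theorem diag_smul_left (c : ι → F) (r : R) (x z : ι → R) :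
    diag c (r • x) z = r * diag c x z := by
  simp [diag, Finset.mul_sum, mul_assoc]

theorem diag_sub_left (c : ι → F) (x y z : ι → R) :
    diag c (x - y) z = diag c x z - diag c y z := by
  simp [diag, sub_mul, smul_sub, Finset.sum_sub_distrib]

theorem diag_add_right (c : ι → F) (x y z : ι → R) :
    diag c z (x + y) = diag c z x + diag c z y := by
  simp only [diag_comm c z, diag_add_left]

theorem diag_smul_right (c : ι → F) (r : R) (x z : ι → R) :
    diag c z (r • x) = r * diag c z x := by
  simp only [diag_comm c z, diag_smul_left]

theorem diag_sub_right (c : ι → F) (x y z : ι → R) :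
    diag c z (x - y) = diag c z x - diag c z y := by
  simp only [diag_comm c z, diag_sub_left]

theorem diag_map {G : Type*} [FunLike G R R'] [AlgHomClass G F R R'] (f : G) (c : ι → F)
    (x y : ι → R) :
    diag c (fun i => f (x i)) (fun i => f (y i)) = f (diag c x y) := by
  simp [diag, map_sum, map_smul, map_mul]

/-- The vectors over an `F`-algebra `R` solving the homogeneous linear equations `S` over `F`. -/
def sol (R : Type*) [CommRing R] [Algebra F R] (S : Set (ι → F)) : Submodule R (ι → R) where
  carrier := {x | ∀ e ∈ S, ∑ i, e i • x i = 0}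
  zero_mem' := by simp
  add_mem' := by
    intro x y hx hy e he
    simp [smul_add, Finset.sum_add_distrib, hx e he, hy e he]
  smul_mem' := by
    intro r x hx e he
    have := congrArg (r * ·) (hx e he)
    simpa [Finset.mul_sum] using this

theorem mem_sol {S : Set (ι → F)} {x : ι → R} :
    x ∈ sol R S ↔ ∀ e ∈ S, ∑ i, e i • x i = 0 := Iff.rfl

theorem map_mem_sol {S : Set (ι → F)} {x : ι → R} (hx : x ∈ sol R S) {G : Type*} [FunLike G R R']
    [LinearMapClass G F R R'] (f : G) : (fun i => f (x i)) ∈ sol R' S := by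
  intro e he
  have := congrArg f (hx e he)
  simpa [map_sum, map_smul] using this

/-- The diagonal form with weights `c` is anisotropic on the solutions of `S` over `R`. -/
def AnisotropicOn (R : Type*) [CommRing R] [Algebra F R] (c : ι → F) (S : Set (ι → F)) : Prop :=
  ∀ x ∈ sol R S, diag c x x = 0 → x = 0

theorem AnisotropicOn.of_injective {c : ι → F} {S : Set (ι → F)} (h : AnisotropicOn R' c S)
    (f : R →ₐ[F] R') (hf : Function.Injective f) : AnisotropicOn R c S := by
  intro x hx hx0
  have := h _ (map_mem_sol hx f) (by rw [diag_map, hx0, map_zero])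
  funext i
  exact hf (by simpa using congrFun this i)

theorem exists_common_denominator [IsDomain R] (K : Type*) [Field K] [Algebra R K]
    [IsFractionRing R K] (x : ι → K) :
    ∃ (g : R) (y : ι → R), g ≠ 0 ∧ ∀ i, algebraMap R K (y i) = algebraMap R K g * x i := by
  obtain ⟨b, hb⟩ := IsLocalization.exist_integer_multiples_of_finite (nonZeroDivisors R) x
  choose y hy using hb
  exact ⟨b, y, nonZeroDivisors.coe_ne_zero b, fun i => by rw [hy, Algebra.smul_def]⟩

theorem mem_sol_of_map {S : Set (ι → F)} {x : ι → R} (f : R →ₐ[F] R')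
    (hf : Function.Injective f) (hx : (fun i => f (x i)) ∈ sol R' S) : x ∈ sol R S := by
  intro e he
  apply hf
  simpa [map_sum, map_smul] using hx e he

theorem exists_scaled_preimage [IsDomain R] {K : Type*} [Field K] [Algebra R K] [Algebra F K]
    [IsScalarTower F R K] [IsFractionRing R K] {c : ι → F} {S : Set (ι → F)} {x : ι → K}
    (hx : x ∈ sol K S) {a : R} (e : diag c x x = algebraMap R K a) :
    ∃ (g : R) (y : ι → R), g ≠ 0 ∧ y ∈ sol R S ∧ diag c y y = g ^ 2 * a ∧
      ∀ i, algebraMap R K (y i) = algebraMap R K g * x i := by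
  obtain ⟨g, y, hg, hy⟩ := exists_common_denominator (R := R) K x
  have hinj : Function.Injective (IsScalarTower.toAlgHom F R K) := IsFractionRing.injective R K
  have hy' : (fun i => IsScalarTower.toAlgHom F R K (y i)) = algebraMap R K g • x := by
    funext i; simp [hy]
  refine ⟨g, y, hg, mem_sol_of_map _ hinj ?_, hinj ?_, hy⟩
  · rw [hy']
    exact (sol K S).smul_mem _ hx
  · rw [← diag_map, hy', diag_smul_left, diag_smul_right, e]
    simp only [IsScalarTower.coe_toAlgHom', map_mul, map_pow]
    ring

theorem AnisotropicOn.fractionRing [IsDomain R] {K : Type*} [Field K] [Algebra R K] [Algebra F K]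
    [IsScalarTower F R K] [IsFractionRing R K] {c : ι → F} {S : Set (ι → F)}
    (h : AnisotropicOn R c S) : AnisotropicOn K c S := by
  intro x hx hx0
  obtain ⟨g, y, hg, hys, hy0, hy⟩ := exists_scaled_preimage (R := R) hx (a := 0)
    (by rw [hx0, map_zero])
  have hy0 := h y hys (by rw [hy0, mul_zero])
  funext i
  have := hy i
  simp only [hy0, Pi.zero_apply, map_zero] at this
  have hg' : algebraMap R K g ≠ 0 := by
    simpa using hg
  simpa [hg'] using this.symm

open Polynomial in
theorem coeff_diag_of_natDegree_le {c : ι → F} {x : ι → R[X]} {M : ℕ}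
    (hM : ∀ i, (x i).natDegree ≤ M) :
    (diag c x x).coeff (2 * M) = diag c (fun i => (x i).coeff M) (fun i => (x i).coeff M) := by
  simp only [diag, finsetSum_coeff, coeff_smul]
  refine Finset.sum_congr rfl fun i _ => ?_
  rw [two_mul, coeff_mul_add_eq_of_natDegree_le (hM i) (hM i)]

open Polynomial in
theorem coeff_one_diag (c : ι → F) (x : ι → R[X]) :
    (diag c x x).coeff 1 = 2 * diag c (fun i => (x i).coeff 0) (fun i => (x i).coeff 1) := by
  simp only [diag, finsetSum_coeff, coeff_smul, mul_coeff_one, Finset.mul_sum]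
  refine Finset.sum_congr rfl fun i _ => ?_
  rw [mul_comm ((x i).coeff 1), ← two_mul, mul_smul_comm]

open Polynomial in
theorem coeff_mem_sol {S : Set (ι → F)} {x : ι → R[X]} (hx : x ∈ sol R[X] S) (M : ℕ) :
    (fun i => (x i).coeff M) ∈ sol R S :=
  map_mem_sol hx ((lcoeff R M).restrictScalars F)

open Polynomial in
-- Leading terms cannot cancel: the coefficients at the maximal degree form a nonzero solution of
-- `S`, on which the form does not vanish.
theorem AnisotropicOn.exists_coeff_ne_zero {c : ι → F} {S : Set (ι → F)}
    (h : AnisotropicOn R c S) {x : ι → R[X]} (hx : x ∈ sol R[X] S) (hx0 : x ≠ 0) :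
    ∃ M, (∀ i, (x i).natDegree ≤ M) ∧ (diag c x x).coeff (2 * M) ≠ 0 := by
  obtain ⟨i, hi⟩ := Function.ne_iff.1 hx0
  obtain ⟨k, -, hk⟩ := Finset.exists_max_image (Finset.univ : Finset ι)
    (fun i => (x i).degree) ⟨i, Finset.mem_univ i⟩
  have hk0 : x k ≠ 0 := by
    intro h0
    have := hk i (Finset.mem_univ i)
    rw [h0, degree_zero, le_bot_iff, degree_eq_bot] at this
    exact hi this
  refine ⟨(x k).natDegree, fun i => natDegree_le_natDegree (hk i (Finset.mem_univ i)), ?_⟩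
  rw [coeff_diag_of_natDegree_le fun i => natDegree_le_natDegree (hk i (Finset.mem_univ i))]
  intro h0
  have := congrFun (h _ (coeff_mem_sol hx _) h0) k
  simp [hk0] at this

open Polynomial in
theorem AnisotropicOn.polynomial {c : ι → F} {S : Set (ι → F)} (h : AnisotropicOn R c S) :
    AnisotropicOn R[X] c S := by
  intro x hx h0
  by_contra hne
  obtain ⟨M, -, hM⟩ := h.exists_coeff_ne_zero hx hne
  simp [h0] at hM

open Polynomial in
theorem AnisotropicOn.natDegree_le {c : ι → F} {S : Set (ι → F)} (h : AnisotropicOn R c S)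
    {x : ι → R[X]} (hx : x ∈ sol R[X] S) {D : ℕ} (hD : (diag c x x).natDegree ≤ 2 * D) (i : ι) :
    (x i).natDegree ≤ D := by
  by_cases hne : x = 0
  · simp [hne]
  obtain ⟨M, hM, hM'⟩ := h.exists_coeff_ne_zero hx hne
  have := le_natDegree_of_ne_zero hM'
  exact (hM i).trans (by omega)

theorem AnisotropicOn.mvPolynomial {c : ι → F} {S : Set (ι → F)} (h : AnisotropicOn F c S)
    (n : ℕ) : AnisotropicOn (MvPolynomial (Fin n) F) c S := by
  induction n with
  | zero =>
    exact h.of_injective (MvPolynomial.isEmptyAlgEquiv F (Fin 0)).toAlgHom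
      (MvPolynomial.isEmptyAlgEquiv F (Fin 0)).injective
  | succ n ih =>
    exact ih.polynomial.of_injective
      ((MvPolynomial.finSuccEquiv F n).toAlgHom.restrictScalars F)
      (MvPolynomial.finSuccEquiv F n).injective

open Polynomial in
/-- Representation of constants by an anisotropic form descends along adjoining a variable. -/
theorem AnisotropicOn.represents_polynomial [IsDomain R] {c : ι → F} {S : Set (ι → F)}
    (h : AnisotropicOn R c S) {a : R} {g : R[X]} (hg : g ≠ 0) {x : ι → R[X]}
    (hx : x ∈ sol R[X] S) (e : diag c x x = g ^ 2 * C a) :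
    ∃ (g' : R) (y : ι → R), g' ≠ 0 ∧ y ∈ sol R S ∧ diag c y y = g' ^ 2 * a := by
  -- Anisotropy bounds every deg xᵢ by deg g, so comparing coefficients in degree 2 deg g gives the
  -- identity over `R`.
  refine ⟨g.coeff g.natDegree, fun i => (x i).coeff g.natDegree, by simpa using hg,
    coeff_mem_sol hx _, ?_⟩
  rw [← coeff_diag_of_natDegree_le, e, coeff_mul_C, sq, two_mul,
    coeff_mul_add_eq_of_natDegree_le le_rfl le_rfl, sq]
  refine h.natDegree_le hx ?_
  rw [e]
  refine natDegree_mul_le.trans ?_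
  rw [natDegree_C, natDegree_pow, add_zero]

/-- Variables are removed one at a time. The denominator `g` is carried along and only inverted at
the end, when it is a nonzero constant. -/
theorem AnisotropicOn.represents_mvPolynomial {c : ι → F} {S : Set (ι → F)}
    (h : AnisotropicOn F c S) {a : F} {n : ℕ} {g : MvPolynomial (Fin n) F} (hg : g ≠ 0)
    {x : ι → MvPolynomial (Fin n) F} (hx : x ∈ sol _ S)
    (e : diag c x x = g ^ 2 * MvPolynomial.C a) : ∃ y ∈ sol F S, diag c y y = a := by
  induction n with
  | zero =>
    set f := MvPolynomial.isEmptyAlgEquiv F (Fin 0)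
    have hg' : f g ≠ 0 := by simpa using hg
    refine ⟨(f g)⁻¹ • fun i => f (x i), Submodule.smul_mem _ _ (map_mem_sol hx f), ?_⟩
    have : f (MvPolynomial.C a) = a := f.commutes a
    rw [diag_smul_left, diag_smul_right, diag_map, e, map_mul, map_pow, this]
    field_simp
  | succ n ih =>
    set f := MvPolynomial.finSuccEquiv F n
    have hC : f (MvPolynomial.C a) = Polynomial.C (MvPolynomial.C a) := f.commutes a
    obtain ⟨g', y, hg', hy, e'⟩ := (h.mvPolynomial n).represents_polynomial (g := f g)
      (by simpa using hg) (map_mem_sol hx f) (a := MvPolynomial.C a)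
      (by rw [diag_map, e, map_mul, map_pow, hC])
    exact ih hg' hy e'

open Polynomial in
/-- The Cassels-Pfister theorem: an anisotropic form representing a polynomial over the rational
functions represents it over the polynomials. -/
theorem AnisotropicOn.cassels_pfister {K : Type*} [Field K] [Algebra F K] {c : ι → F}
    {S : Set (ι → F)} (h : AnisotropicOn K c S) {p g : K[X]} (hg : g.Monic) {f : ι → K[X]}
    (hf : f ∈ sol K[X] S) (e : diag c f f = g ^ 2 * p) :
    ∃ x ∈ sol K[X] S, diag c x x = p := by
  induction hn : g.natDegree using Nat.strong_induction_on generalizing f g with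
  | _ n ih =>
  subst hn
  set r : ι → K[X] := fun i => f i %ₘ g with hr
  set k : ι → K[X] := fun i => f i /ₘ g with hk
  have hrs : r ∈ sol K[X] S := map_mem_sol hf ((modByMonicHom g).restrictScalars F)
  have hrk : r = f - g • k := by
    funext i
    simp only [hr, hk, Pi.sub_apply, Pi.smul_apply, smul_eq_mul]
    rw [modByMonic_eq_sub_mul_div]
  have hks : k ∈ sol K[X] S := by
    intro s hs
    have h1 : g • k ∈ sol K[X] S := by
      have : g • k = f - r := by rw [hrk]; abel
      rw [this]
      exact Submodule.sub_mem _ hf hrs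
    have h2 := h1 s hs
    have h3 : g * ∑ i, s i • k i = 0 := by
      rw [Finset.mul_sum, ← h2]
      simp
    exact (mul_eq_zero.1 h3).resolve_left hg.ne_zero
  by_cases hr0 : r = 0
  · refine ⟨k, hks, ?_⟩
    have hfk : f = g • k := by rw [hr0] at hrk; exact (sub_eq_zero.1 hrk.symm)
    rw [hfk, diag_smul_left, diag_smul_right] at e
    have : g ^ 2 * (diag c k k - p) = 0 := by linear_combination e
    exact sub_eq_zero.1 ((mul_eq_zero.1 this).resolve_left (pow_ne_zero _ hg.ne_zero))
  -- The line through f/g and k meets the quadric of value p in a second point, (Af - Bk)/g'. Since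
  -- g'g is the value of the remainder r, of degree at most 2(deg g - 1), the new denominator has
  -- smaller degree.
  set A := diag c k k - p with hA
  set B := 2 * diag c f k - 2 * g * p with hB
  set g' := A * g - B with hg'
  have key : g' * g = diag c r r := by
    rw [hrk]
    simp only [diag_sub_left, diag_sub_right, diag_smul_left, diag_smul_right, e,
      diag_comm c k f, hg', hA, hB]
    ring
  have key2 : diag c (A • f - B • k) (A • f - B • k) = g' ^ 2 * p := by
    simp only [diag_sub_left, diag_sub_right, diag_smul_left, diag_smul_right, e,
      diag_comm c k f, hg']
    linear_combination A * B * hB - B ^ 2 * hA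
  have hrr : diag c r r ≠ 0 := fun h0 => hr0 (h.polynomial r hrs h0)
  have hg'0 : g' ≠ 0 := by
    intro h0
    rw [h0, zero_mul] at key
    exact hrr key.symm
  have hg1 : g ≠ 1 := by
    rintro rfl
    exact hr0 (funext fun i => modByMonic_one _)
  have hdr : (diag c r r).natDegree ≤ 2 * (g.natDegree - 1) := by
    refine natDegree_sum_le_of_forall_le _ _ fun i _ => (natDegree_smul_le _ _).trans ?_
    refine natDegree_mul_le.trans ?_
    have := natDegree_modByMonic_lt (f i) hg hg1
    simp only [hr]
    omega
  rw [← key, natDegree_mul hg'0 hg.ne_zero] at hdr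
  have hpos : g.natDegree ≠ 0 := fun h0 => hg1 (hg.natDegree_eq_zero.1 h0)
  have hlc : g'.leadingCoeff ≠ 0 := leadingCoeff_ne_zero.2 hg'0
  refine ih (g' * C g'.leadingCoeff⁻¹).natDegree ?_ (monic_mul_leadingCoeff_inv hg'0)
    (f := C g'.leadingCoeff⁻¹ • (A • f - B • k)) ?_ ?_ rfl
  · rw [natDegree_mul_leadingCoeff_inv _ hg'0]
    omega
  · exact Submodule.smul_mem _ _ (Submodule.sub_mem _ (Submodule.smul_mem _ _ hf)
      (Submodule.smul_mem _ _ hks))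
  · rw [diag_smul_left, diag_smul_right, key2]
    ring

open Polynomial in
theorem AnisotropicOn.cassels_pfister' {K : Type*} [Field K] [Algebra F K] {c : ι → F}
    {S : Set (ι → F)} (h : AnisotropicOn K c S) {p g : K[X]} (hg : g ≠ 0) {f : ι → K[X]}
    (hf : f ∈ sol K[X] S) (e : diag c f f = g ^ 2 * p) :
    ∃ x ∈ sol K[X] S, diag c x x = p := by
  refine h.cassels_pfister (monic_mul_leadingCoeff_inv hg)
    (Submodule.smul_mem _ (C g.leadingCoeff⁻¹) hf) ?_
  rw [diag_smul_left, diag_smul_right, e]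
  ring

/-- A reflection moving `x₁` to `e`, applied to a vector orthogonal to `x₁`. -/
theorem AnisotropicOn.exists_orthogonal {K : Type*} [Field K] [Algebra F K] {c : ι → F}
    {S : Set (ι → F)} (h : AnisotropicOn K c S) (h2 : (2 : K) ≠ 0) {x₀ x₁ e : ι → K}
    (h₀ : x₀ ∈ sol K S) (h₁ : x₁ ∈ sol K S) (he : e ∈ sol K S)
    (hq : diag c x₁ x₁ = diag c e e) (ho : diag c x₀ x₁ = 0) :
    ∃ z ∈ sol K S, diag c z z = diag c x₀ x₀ ∧ diag c z e = 0 := by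
  by_cases hw : x₁ - e = 0
  · exact ⟨x₀, h₀, rfl, by rw [← sub_eq_zero.1 hw, ho]⟩
  have hws := Submodule.sub_mem _ h₁ he
  have hw0 : diag c (x₁ - e) (x₁ - e) ≠ 0 := fun h0 => hw (h _ hws h0)
  have e1 : diag c (x₁ - e) (x₁ - e) = -2 * diag c (x₁ - e) e := by
    simp only [diag_sub_left, diag_sub_right, diag_comm c e x₁]
    linear_combination hq
  have e2 : diag c x₀ (x₁ - e) = - diag c x₀ e := by
    rw [diag_sub_right, ho, zero_sub]
  set w := x₁ - e
  have hwe : diag c w e ≠ 0 := fun h0 => hw0 (by rw [e1, h0, mul_zero])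
  refine ⟨x₀ - (2 * diag c x₀ w / diag c w w) • w,
    Submodule.sub_mem _ h₀ (Submodule.smul_mem _ _ hws), ?_, ?_⟩
  · simp only [diag_sub_left, diag_sub_right, diag_smul_left, diag_smul_right, diag_comm c w x₀]
    field_simp
    ring
  · simp only [diag_sub_left, diag_smul_left]
    rw [e1, e2]
    field_simp
    ring

/-- The Cassels-Pfister subform theorem: an anisotropic form representing the generic value of a
diagonal form contains the latter. -/
theorem AnisotropicOn.subform {c : ι → F} {S : Set (ι → F)} (h2 : (2 : F) ≠ 0)
    (h : AnisotropicOn F c S) {n : ℕ} (α : Fin n → F)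
    {f : ι → MvPolynomial (Fin n) F} (hf : f ∈ sol _ S) {g : MvPolynomial (Fin n) F} (hg : g ≠ 0)
    (e : diag c f f = g ^ 2 * ∑ i, MvPolynomial.C (α i) * MvPolynomial.X i ^ 2) :
    ∃ j : (Fin n → F) →ₗ[F] (ι → F), ∀ y, j y ∈ sol F S ∧
      diag c (j y) (j y) = ∑ i, α i * y i ^ 2 := by
  induction n generalizing S with
  | zero => exact ⟨0, fun y => ⟨Submodule.zero_mem _, by simp [diag]⟩⟩
  | succ n ih =>
    set R := MvPolynomial (Fin n) F
    set K := FractionRing R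
    set Φ : MvPolynomial (Fin (n + 1)) F →ₐ[F] Polynomial K :=
      (Polynomial.mapAlgHom (IsScalarTower.toAlgHom F R K)).comp
        ((MvPolynomial.finSuccEquiv F n).toAlgHom.restrictScalars F) with hΦ
    have hRK : Function.Injective (algebraMap R K) := IsFractionRing.injective R K
    have hinj : Function.Injective Φ :=
      (Polynomial.map_injective _ hRK).comp (MvPolynomial.finSuccEquiv F n).injective
    set d : R := ∑ i, MvPolynomial.C (α i.succ) * MvPolynomial.X i ^ 2 with hd
    have hΦC : ∀ a : F, Φ (MvPolynomial.C a) = Polynomial.C (algebraMap F K a) := fun a =>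
      Φ.commutes a
    have hX0 : Φ (MvPolynomial.X 0) = Polynomial.X := by
      simp [hΦ, MvPolynomial.finSuccEquiv_X_zero]
    have hXs : ∀ i : Fin n, Φ (MvPolynomial.X i.succ) =
        Polynomial.C (algebraMap R K (MvPolynomial.X i)) := fun i => by
      simp [hΦ, MvPolynomial.finSuccEquiv_X_succ]
    have hRC : ∀ a : F, algebraMap R K (MvPolynomial.C a) = algebraMap F K a := fun a =>
      (IsScalarTower.algebraMap_apply F R K a).symm
    have hΦp : Φ (∑ i, MvPolynomial.C (α i) * MvPolynomial.X i ^ 2) =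
        Polynomial.C (algebraMap F K (α 0)) * Polynomial.X ^ 2 +
          Polynomial.C (algebraMap R K d) := by
      rw [Fin.sum_univ_succ, map_add, map_mul, map_pow, hΦC, hX0, map_sum, hd, map_sum, map_sum]
      congr 1
      refine Finset.sum_congr rfl fun i _ => ?_
      rw [map_mul, map_pow, hΦC, hXs, map_mul, map_pow, hRC, map_mul, map_pow]
    have h2K : (2 : K) ≠ 0 := by
      rw [← map_ofNat (algebraMap F K)]
      exact (map_ne_zero_iff (algebraMap F K) (algebraMap F K).injective).2 h2
    have hK := (h.mvPolynomial n).fractionRing (K := K)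
    -- With the remaining variables put into K, the generic value is α₀X² + d. A polynomial solution
    -- has degree at most one, x = x₀ + x₁X, so the values at x₁ and x₀ are α₀ and d, and x₀ ⟂ x₁.
    obtain ⟨x, hxs, hx⟩ := hK.cassels_pfister' (g := Φ g)
      (by rwa [Ne, map_eq_zero_iff _ hinj]) (map_mem_sol hf Φ)
      (by rw [diag_map, e, map_mul, map_pow])
    rw [hΦp] at hx
    have hdeg : ∀ i, (x i).natDegree ≤ 1 := by
      refine hK.natDegree_le hxs ?_
      rw [hx]
      compute_degree
    have q1 := coeff_diag_of_natDegree_le (c := c) hdeg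
    have q0 : diag c (fun i => (x i).coeff 0) (fun i => (x i).coeff 0) = algebraMap R K d := by
      have := congrArg (Polynomial.coeff · 0) hx
      simpa [diag, Polynomial.mul_coeff_zero] using this
    have q01 : diag c (fun i => (x i).coeff 0) (fun i => (x i).coeff 1) = 0 := by
      have e2 : (Polynomial.C (algebraMap F K (α 0)) * Polynomial.X ^ 2 +
          Polynomial.C (algebraMap R K d)).coeff 1 = 0 := by
        simp
      rw [← hx, coeff_one_diag] at e2
      exact (mul_eq_zero.1 e2).resolve_left h2K
    rw [hx] at q1
    have q1' : diag c (fun i => (x i).coeff 1) (fun i => (x i).coeff 1) =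
        algebraMap F K (α 0) := by
      rw [← q1]
      simp
    set x₀ : ι → K := fun i => (x i).coeff 0
    set x₁ : ι → K := fun i => (x i).coeff 1
    have hx₀ : x₀ ∈ sol K S := coeff_mem_sol hxs 0
    have hx₁ : x₁ ∈ sol K S := coeff_mem_sol hxs 1
    -- The vector x₁ lives over K, but its value α₀ is constant, hence is also taken at some e₁ over
    -- F. A reflection then moves x₀ into the complement of e₁.
    obtain ⟨g₁, y₁, hg₁, hy₁s, hy₁, -⟩ := exists_scaled_preimage (R := R) hx₁
      (a := MvPolynomial.C (α 0)) (by rw [q1', hRC])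
    obtain ⟨e₁, he₁s, he₁⟩ := h.represents_mvPolynomial hg₁ hy₁s hy₁
    set E : ι → K := fun i => algebraMap F K (e₁ i)
    have hEs : E ∈ sol K S := map_mem_sol he₁s (Algebra.ofId F K)
    have hE : diag c E E = algebraMap F K (α 0) := by
      rw [← he₁]
      exact diag_map (Algebra.ofId F K) c e₁ e₁
    obtain ⟨z, hzs, hz, hzE⟩ := hK.exists_orthogonal h2K hx₀ hx₁ hEs (by rw [q1', hE]) q01
    -- The added equation is orthogonality to e₁; the induction continues inside this complement.
    have hzs' : z ∈ sol K (insert (fun i => c i * e₁ i) S) := by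
      rintro e (rfl | he)
      · rw [← hzE]
        refine Finset.sum_congr rfl fun i _ => ?_
        simp only [E, Algebra.smul_def, map_mul]
        ring
      · exact hzs e he
    obtain ⟨g₂, y₂, hg₂, hy₂s, hy₂, -⟩ := exists_scaled_preimage (R := R) hzs' (a := d)
      (by rw [hz, q0])
    have h' : AnisotropicOn F c (insert (fun i => c i * e₁ i) S) := fun x hx =>
      h x fun e he => hx e (Set.mem_insert_of_mem _ he)
    obtain ⟨j, hj⟩ := ih h' (fun i => α i.succ) hy₂s hg₂ hy₂
    refine ⟨(LinearMap.proj 0 : (Fin (n + 1) → F) →ₗ[F] F).smulRight e₁ +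
      j ∘ₗ LinearMap.funLeft F F Fin.succ, fun y => ?_⟩
    obtain ⟨hjs, hjq⟩ := hj (fun i => y i.succ)
    have hj' : ((LinearMap.proj 0 : (Fin (n + 1) → F) →ₗ[F] F).smulRight e₁ +
      j ∘ₗ LinearMap.funLeft F F Fin.succ) y =
      y 0 • e₁ + j (fun i => y i.succ) := rfl
    have ho : diag c e₁ (j fun i => y i.succ) = 0 := by
      rw [← hjs _ (Set.mem_insert _ _)]
      refine Finset.sum_congr rfl fun i _ => ?_
      simp only [smul_eq_mul]
      ring
    rw [hj']
    refine ⟨Submodule.add_mem _ (Submodule.smul_mem _ _ he₁s)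
      fun e he => hjs e (Set.mem_insert_of_mem _ he), ?_⟩
    rw [Fin.sum_univ_succ, ← hjq]
    simp only [diag_add_left, diag_add_right, diag_smul_left, diag_smul_right, he₁, ho,
      diag_comm c _ e₁]
    ring

end Diagonal

/-! ### From divisibility by the generic value to its representation. -/

section Generic

variable {F : Type*} [Field F] {ι : Type*} [Fintype ι]

/-- The generic value `∑ αᵢ Xᵢ²` of a diagonal form. -/
def genericValue {n : ℕ} (α : Fin n → F) : MvPolynomial (Fin n) F :=
  ∑ i, MvPolynomial.C (α i) * MvPolynomial.X i ^ 2

open Polynomial in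
/-- A form that is anisotropic over a domain `R` and isotropic modulo `X² + d` represents
`X² + d` up to one of its values. -/
theorem AnisotropicOn.exists_of_dvd {R : Type*} [CommRing R] [IsDomain R] [Algebra F R]
    {c : ι → F} (h : AnisotropicOn R c ∅) (d : R) {f : ι → R[X]} {i : ι}
    (hi : ¬ X ^ 2 + C d ∣ f i) (hf : X ^ 2 + C d ∣ diag c f f) :
    ∃ (w : ι → R[X]) (v : ι → R), diag c v v ≠ 0 ∧
      diag c w w = (X ^ 2 + C d) * C (diag c v v) := by
  set m : R[X] := X ^ 2 + C d with hm
  have hmm : m.Monic := monic_X_pow_add_C d two_ne_zero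
  have hmd : m.natDegree = 2 := natDegree_X_pow_add_C
  set w : ι → R[X] := fun i => f i %ₘ m
  set k : ι → R[X] := fun i => f i /ₘ m
  have hwk : w = f - m • k := by
    funext i
    simp only [w, k, Pi.sub_apply, Pi.smul_apply, smul_eq_mul]
    rw [modByMonic_eq_sub_mul_div]
  have hdw : m ∣ diag c w w := by
    have : diag c w w = diag c f f + m * (m * diag c k k - 2 * diag c f k) := by
      rw [hwk]
      simp only [diag_sub_left, diag_sub_right, diag_smul_left, diag_smul_right, diag_comm c k f]
      ring
    rw [this]
    exact dvd_add hf (dvd_mul_right _ _)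
  obtain ⟨t, ht⟩ := hdw
  have hw0 : w ≠ 0 := by
    intro h0
    exact hi ((modByMonic_eq_zero_iff_dvd hmm).1 (congrFun h0 i))
  have hq0 : diag c w w ≠ 0 := fun h0 => hw0 (h.polynomial w (by simp [mem_sol]) h0)
  have ht0 : t ≠ 0 := by
    rintro rfl
    exact hq0 (by rw [ht, mul_zero])
  have hm1 : m ≠ 1 := by
    intro h1
    rw [h1, natDegree_one] at hmd
    omega
  have hwd : ∀ i, (w i).natDegree ≤ 1 := fun i => by
    have := natDegree_modByMonic_lt (f i) hmm hm1
    simp only [w]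
    omega
  have hqd : (diag c w w).natDegree ≤ 2 := by
    refine natDegree_sum_le_of_forall_le _ _ fun i _ => (natDegree_smul_le _ _).trans ?_
    refine natDegree_mul_le.trans ?_
    have := hwd i
    omega
  -- The value at w has degree at most 2 and is a nonzero multiple of the quadratic m, so the
  -- cofactor is constant. Its value is read off from the coefficients of degree 2.
  have htd : t.natDegree = 0 := by
    rw [ht, natDegree_mul hmm.ne_zero ht0] at hqd
    omega
  obtain ⟨s, rfl⟩ := natDegree_eq_zero.1 htd
  have hs : diag c (fun i => (w i).coeff 1) (fun i => (w i).coeff 1) = s := by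
    rw [← coeff_diag_of_natDegree_le hwd, ht, coeff_mul_C]
    simp [hm]
  refine ⟨w, fun i => (w i).coeff 1, ?_, by rw [ht, hs]⟩
  rw [hs]
  rintro rfl
  simp at ht0

/-- In the variable X₀ the generic value is α₀(X₀² + d), so `AnisotropicOn.exists_of_dvd` applies.
It yields X₀² + d only up to a factor that is a value of the form; closure of the values under
products over K removes this factor modulo squares. -/
theorem AnisotropicOn.exists_represents_genericValue {c : ι → F} (h : AnisotropicOn F c ∅) {n : ℕ}
    {K : Type*} [Field K] [Algebra F K] [Algebra (MvPolynomial (Fin (n + 1)) F) K]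
    [IsScalarTower F (MvPolynomial (Fin (n + 1)) F) K]
    [IsFractionRing (MvPolynomial (Fin (n + 1)) F) K]
    (hm : ∀ x y : ι → K, ∃ z, diag c z z = diag c x x * diag c y y)
    {α : Fin (n + 1) → F} (hα : α 0 ≠ 0) {f : ι → MvPolynomial (Fin (n + 1)) F} {i : ι}
    (hi : ¬ genericValue α ∣ f i) (hf : genericValue α ∣ diag c f f) :
    ∃ (g : MvPolynomial (Fin (n + 1)) F) (z : ι → MvPolynomial (Fin (n + 1)) F), g ≠ 0 ∧
      diag c z z = g ^ 2 * genericValue fun i => α 0 * α i := by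
  set R := MvPolynomial (Fin n) F
  set σ := MvPolynomial.finSuccEquiv F n
  set d : R := MvPolynomial.C (α 0)⁻¹ * ∑ i, MvPolynomial.C (α i.succ) * MvPolynomial.X i ^ 2
    with hd
  have hC : ∀ a : F, σ (MvPolynomial.C a) = Polynomial.C (MvPolynomial.C a) := fun a =>
    σ.commutes a
  have hCα : (MvPolynomial.C (α 0) * MvPolynomial.C (α 0)⁻¹ : R) = 1 := by
    rw [← map_mul, mul_inv_cancel₀ hα, map_one]
  have hσ : σ (genericValue α) =
      Polynomial.C (MvPolynomial.C (α 0)) * (Polynomial.X ^ 2 + Polynomial.C d) := by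
    rw [genericValue, Fin.sum_univ_succ, map_add, map_mul, map_pow, hC,
      MvPolynomial.finSuccEquiv_X_zero, mul_add, ← Polynomial.C_mul, hd, ← mul_assoc, hCα, one_mul,
      map_sum, map_sum]
    congr 1
    refine Finset.sum_congr rfl fun i _ => ?_
    rw [map_mul, map_pow, hC, MvPolynomial.finSuccEquiv_X_succ, map_mul, map_pow]
  have hu : IsUnit (Polynomial.C (MvPolynomial.C (α 0)) : Polynomial R) :=
    ((isUnit_iff_ne_zero.2 hα).map MvPolynomial.C).map Polynomial.C
  have hdvd : ∀ p, genericValue α ∣ p ↔ Polynomial.X ^ 2 + Polynomial.C d ∣ σ p := by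
    intro p
    rw [← map_dvd_iff σ, hσ, hu.mul_left_dvd]
  obtain ⟨w, v, hv, hw⟩ := (h.mvPolynomial n).exists_of_dvd (f := fun i => σ (f i)) d
    (mt (hdvd _).2 hi) (by rw [diag_map]; exact (hdvd _).1 hf)
  set w' : ι → MvPolynomial (Fin (n + 1)) F := fun i => σ.symm (w i)
  set v' : ι → MvPolynomial (Fin (n + 1)) F := fun i => σ.symm (Polynomial.C (v i))
  have hv' : σ (diag c v' v') = Polynomial.C (diag c v v) := by
    rw [← diag_map]
    simp only [v', AlgEquiv.apply_symm_apply]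
    exact diag_map ((Polynomial.CAlgHom (R := R) (A := R)).restrictScalars F) c v v
  have hw' : σ (diag c w' w') = diag c w w := by
    rw [← diag_map]
    simp only [w', AlgEquiv.apply_symm_apply]
  have key : MvPolynomial.C (α 0) * diag c w' w' = genericValue α * diag c v' v' := by
    apply σ.injective
    rw [map_mul, map_mul, hC, hw', hw, hσ, hv', mul_assoc]
  have hv0 : diag c v' v' ≠ 0 := by
    intro h0
    rw [h0, map_zero] at hv'
    exact hv (by simpa using hv'.symm)
  set ρ : MvPolynomial (Fin (n + 1)) F →ₐ[F] K := IsScalarTower.toAlgHom F _ K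
  have hρ : Function.Injective ρ := IsFractionRing.injective (MvPolynomial (Fin (n + 1)) F) K
  obtain ⟨z, hz⟩ := hm (fun i => ρ (v' i)) (fun i => ρ (w' i))
  rw [diag_map ρ c v' v', diag_map ρ c w' w'] at hz
  have hρv : ρ (diag c v' v') ≠ 0 := by rwa [Ne, map_eq_zero_iff _ hρ]
  obtain ⟨g, y, hg, -, hy, -⟩ := exists_scaled_preimage
    (R := MvPolynomial (Fin (n + 1)) F) (S := ∅) (c := c)
    (x := (ρ (MvPolynomial.C (α 0)) / ρ (diag c v' v')) • z) (by simp [mem_sol])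
    (a := MvPolynomial.C (α 0) * genericValue α) (by
      change _ = ρ _
      rw [diag_smul_left, diag_smul_right, hz, map_mul]
      have := congrArg ρ key
      rw [map_mul, map_mul] at this
      field_simp
      linear_combination ρ (MvPolynomial.C (α 0)) * this)
  refine ⟨g, y, hg, ?_⟩
  rw [hy, genericValue, genericValue, Finset.mul_sum]
  congr 1
  refine Finset.sum_congr rfl fun i _ => ?_
  rw [map_mul, mul_assoc]

end Generic

/-! ### Values of a base-changed form in coordinates. -/

section BaseChange

variable {F : Type u} [Field F] [Invertible (2 : F)] {A : Type*} [CommRing A] [Algebra F A]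
  {ι : Type*} [Fintype ι] {W : Type*} [AddCommGroup W] [Module F W]

theorem baseChange_sum_tmul (φ : QuadraticForm F W) (x : ι → A) (v : ι → W) :
    φ.baseChange A (∑ i, x i ⊗ₜ[F] v i) =
      ∑ i, ∑ j, algebraMap F A (QuadraticMap.associated φ (v i) (v j)) * (x i * x j) := by
  let _ : Invertible (2 : A) := (Invertible.map (algebraMap F A) 2).copy _ (map_ofNat _ _).symm
  rw [← QuadraticMap.associated_eq_self_apply A (φ.baseChange A),
    QuadraticForm.associated_baseChange]
  simp only [map_sum, LinearMap.sum_apply, LinearMap.BilinForm.baseChange_tmul]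
  rw [Finset.sum_comm]
  refine Finset.sum_congr rfl fun i _ => Finset.sum_congr rfl fun j _ => ?_
  simp [Algebra.smul_def, mul_comm]
  
theorem baseChange_sum_tmul_of_isOrtho (φ : QuadraticForm F W) (x : ι → A) {v : ι → W}
    (hv : (QuadraticMap.associated φ).IsOrthoᵢ v) :
    φ.baseChange A (∑ i, x i ⊗ₜ[F] v i) = diag (fun i => φ (v i)) x x := by
  rw [baseChange_sum_tmul]
  refine Finset.sum_congr rfl fun i _ => ?_
  rw [Finset.sum_eq_single i]
  · rw [QuadraticMap.associated_eq_self_apply, Algebra.smul_def]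
  · intro j _ hj
    have : QuadraticMap.associated φ (v i) (v j) = 0 := hv hj.symm
    rw [this, map_zero, zero_mul]
  · simp

theorem aeval_poly [Module.Finite F W] (φ : QuadraticForm F W)
    (x : Fin (Module.finrank F W) → A) :
    MvPolynomial.aeval x (poly φ) = φ.baseChange A (∑ i, x i ⊗ₜ[F] Module.finBasis F W i) := by
  rw [baseChange_sum_tmul]
  simp [poly, map_sum]

end BaseChange

/-! ### Isotropy over the function field gives an isometric embedding. -/

section FunctionField

variable {F : Type u} [Field F] [Invertible (2 : F)]
  {ι : Type*} [Fintype ι] {W : Type*} [AddCommGroup W] [Module F W] [Module.Finite F W]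

/-- `poly φ` is written in an arbitrary basis, whereas the reduction modulo X₀² + d needs an
orthogonal one. The left inverse τ is what transports non-divisibility. -/
theorem exists_coordinate_change (φ : QuadraticForm F W) {n : ℕ} (v : Module.Basis (Fin n) F W)
    (hv : (QuadraticMap.associated φ).IsOrthoᵢ v) :
    ∃ (σ : MvPolynomial (Fin (Module.finrank F W)) F →ₐ[F] MvPolynomial (Fin n) F)
      (τ : MvPolynomial (Fin n) F →ₐ[F] MvPolynomial (Fin (Module.finrank F W)) F),
      (∀ p, τ (σ p) = p) ∧ σ (poly φ) = genericValue fun i => φ (v i) := by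
  set b := Module.finBasis F W
  set σ : MvPolynomial (Fin (Module.finrank F W)) F →ₐ[F] MvPolynomial (Fin n) F :=
    MvPolynomial.aeval fun i => ∑ k, b.toMatrix v i k • MvPolynomial.X k with hσ
  set τ : MvPolynomial (Fin n) F →ₐ[F] MvPolynomial (Fin (Module.finrank F W)) F :=
    MvPolynomial.aeval fun k => ∑ i, v.toMatrix b k i • MvPolynomial.X i with hτ
  refine ⟨σ, τ, fun p => ?_, ?_⟩
  · suffices τ.comp σ = AlgHom.id F _ from DFunLike.congr_fun this p
    refine MvPolynomial.algHom_ext fun i => ?_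
    have h1 := b.toMatrix_mul_toMatrix_flip v
    simp only [AlgHom.comp_apply, hσ, hτ, MvPolynomial.aeval_X, map_sum, map_smul,
      Finset.smul_sum, smul_smul, AlgHom.id_apply]
    rw [Finset.sum_comm]
    simp only [← Finset.sum_smul, ← Matrix.mul_apply, h1]
    simp [Matrix.one_apply]
  · rw [hσ, aeval_poly]
    have : ∑ i, (∑ k, b.toMatrix v i k • MvPolynomial.X (R := F) k) ⊗ₜ[F] b i =
        ∑ k, MvPolynomial.X k ⊗ₜ[F] v k := by
      simp only [TensorProduct.sum_tmul, TensorProduct.smul_tmul]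
      rw [Finset.sum_comm]
      simp only [← TensorProduct.tmul_sum]
      refine Finset.sum_congr rfl fun k _ => ?_
      rw [b.sum_toMatrix_smul_self]
    rw [this, baseChange_sum_tmul_of_isOrtho _ _ hv]
    simp [diag, genericValue, MvPolynomial.smul_eq_C_mul, sq]

/-- A multiplicative anisotropic form that becomes isotropic over `F(φ)` contains the multiples of
`φ` by the values of `φ`. -/
theorem exists_isometric_of_isotropic_functionField {φ : QuadraticForm F W}
    (hφ : φ.Anisotropic) (hdim : 2 ≤ Module.finrank F W) {c : ι → F} (h : AnisotropicOn F c ∅)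
    (hm : ∀ (K : Type u) [Field K] [Algebra F K], ∀ x : ι → K, ∃ T : (ι → K) →ₗ[K] (ι → K),
      ∀ y, diag c (T y) (T y) = diag c x x * diag c y y)
    {x : ι → FunctionField φ} (hx0 : x ≠ 0) (hx : diag c x x = 0) {a : F} (ha : a ∈ values φ) :
    ∃ j : W →ₗ[F] (ι → F), ∀ y, diag c (j y) (j y) = a * φ y := by
  have := isDomain_coordRing hφ hdim
  obtain ⟨g, y, hg, hy⟩ := exists_common_denominator (R := CoordRing φ) (FunctionField φ) x
  have hinj : Function.Injective (algebraMap (CoordRing φ) (FunctionField φ)) :=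
    IsFractionRing.injective _ _
  choose f hf using fun i => Ideal.Quotient.mk_surjective (y i)
  obtain ⟨i, hi⟩ := Function.ne_iff.1 hx0
  -- A nonzero coordinate of x stays nonzero after clearing denominators, so its lift is not in the
  -- ideal of φ.
  have hfi : ¬ poly φ ∣ f i := by
    intro hd
    have hyi : y i = 0 := by
      rw [← hf, Ideal.Quotient.eq_zero_iff_mem]
      exact Ideal.mem_span_singleton.2 hd
    have := hy i
    rw [hyi, map_zero, eq_comm, mul_eq_zero] at this
    exact this.elim (by rwa [map_eq_zero_iff _ hinj]) hi
  have hyy : diag c y y = 0 := by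
    apply hinj
    have e1 := diag_map (IsScalarTower.toAlgHom F (CoordRing φ) (FunctionField φ)) c y y
    have e2 : (fun i => IsScalarTower.toAlgHom F (CoordRing φ) (FunctionField φ) (y i)) =
        algebraMap _ (FunctionField φ) g • x := funext hy
    rw [e2, diag_smul_left, diag_smul_right, hx, mul_zero, mul_zero] at e1
    rw [map_zero]
    exact e1.symm
  have hff : poly φ ∣ diag c f f := by
    rw [← Ideal.mem_span_singleton, ← Ideal.Quotient.eq_zero_iff_mem, ← hyy]
    have e1 := diag_map (Ideal.Quotient.mkₐ F (Ideal.span {poly φ})) c f f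
    simp only [Ideal.Quotient.mkₐ_eq_mk, hf] at e1
    exact e1.symm
  obtain ⟨n, hn⟩ : ∃ n, Module.finrank F W = n + 1 := ⟨Module.finrank F W - 1, by omega⟩
  obtain ⟨v', hv'⟩ := LinearMap.BilinForm.exists_orthogonal_basis
    (⟨QuadraticMap.associated_isSymm F φ⟩ :
      (QuadraticMap.associated φ : LinearMap.BilinForm F W).IsSymm)
  set v := v'.reindex (finCongr hn)
  have hv : (QuadraticMap.associated φ).IsOrthoᵢ v := by
    intro k l hkl
    have hkl' : (finCongr hn).symm k ≠ (finCongr hn).symm l := by simpa using hkl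
    simpa [v, Function.onFun] using hv' hkl'
  obtain ⟨σ, τ, hτσ, hσ⟩ := exists_coordinate_change φ v hv
  have hα : ∀ k, φ (v k) ≠ 0 := fun k h0 => v.ne_zero k (hφ _ h0)
  obtain ⟨g', z, hg', hz⟩ := h.exists_represents_genericValue
    (K := FractionRing (MvPolynomial (Fin (n + 1)) F)) (α := fun k => φ (v k))
    (fun x y => (hm _ x).imp' (fun T => T y) fun T hT => hT y) (hα 0)
    (f := fun i => σ (f i)) (i := i)
    (by
      rw [← hσ]
      intro hd
      have := map_dvd τ hd
      rw [hτσ, hτσ] at this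
      exact hfi this)
    (by
      rw [← hσ, diag_map]
      exact map_dvd σ hff)
  obtain ⟨j, hj⟩ := h.subform (Invertible.ne_zero (2 : F)) _ (by simp [mem_sol]) hg' hz
  have hφv : ∀ w, φ w = ∑ k, φ (v k) * v.equivFun w k ^ 2 := by
    intro w
    have := DFunLike.congr_fun (QuadraticMap.basisRepr_eq_of_iIsOrtho φ v hv) (v.equivFun w)
    rw [QuadraticMap.basisRepr_apply, v.sum_equivFun] at this
    rw [this, QuadraticMap.weightedSumSquares_apply]
    simp [sq]
  have hJ : ∀ w, diag c (j (v.equivFun w)) (j (v.equivFun w)) = φ (v 0) * φ w := by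
    intro w
    rw [(hj _).2, hφv w, Finset.mul_sum]
    exact Finset.sum_congr rfl fun k _ => mul_assoc _ _ _
  obtain ⟨-, w₀, rfl⟩ := ha
  -- `j` realises φ(v₀)φ, and T multiplies values by φ(v₀)a, where a = φ(w₀). Scaling the composite
  -- by φ(v₀)⁻¹ leaves aφ.
  obtain ⟨T, hT⟩ := hm F (j (v.equivFun w₀))
  refine ⟨(φ (v 0))⁻¹ • (T ∘ₗ j ∘ₗ v.equivFun.toLinearMap), fun w => ?_⟩
  have e1 := hT (j (v.equivFun w))
  rw [hJ, hJ] at e1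
  have h0 := hα 0
  simp only [LinearMap.smul_apply, diag_smul_left, diag_smul_right, LinearMap.comp_apply,
    LinearEquiv.coe_coe, e1]
  field_simp

end FunctionField

/-! ### Multiplicative forms. -/

section Multiplicative

variable {K : Type*} [Field K] {V : Type*} [AddCommGroup V] [Module K V]
  {V' : Type*} [AddCommGroup V'] [Module K V']

/-- A form is multiplicative if each of its values is the factor of a self-similarity. -/
def IsMultiplicative (Q : QuadraticForm K V) : Prop :=
  ∀ x, ∃ T : V →ₗ[K] V, ∀ y, Q (T y) = Q x * Q y

theorem IsMultiplicative.of_equiv {Q : QuadraticForm K V} (h : IsMultiplicative Q)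
    {Q' : QuadraticForm K V'} (e : V' ≃ₗ[K] V) (he : ∀ x, Q (e x) = Q' x) :
    IsMultiplicative Q' := by
  intro x
  obtain ⟨T, hT⟩ := h (e x)
  refine ⟨e.symm.toLinearMap ∘ₗ T ∘ₗ e.toLinearMap, fun y => ?_⟩
  rw [← he, ← he, ← he, ← hT]
  simp

/-- The form `⟨1, b⟩ ⊗ r` is multiplicative if `r` is. -/
theorem IsMultiplicative.prod_smul {r : QuadraticForm K V} (h : IsMultiplicative r) (b : K) :
    IsMultiplicative (r.prod (b • r)) := by
  rintro ⟨x₁, x₂⟩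
  obtain ⟨S₁, h₁⟩ := h x₁
  obtain ⟨S₂, h₂⟩ := h x₂
  by_cases hx₂ : r x₂ = 0
  · refine ⟨S₁.prodMap S₁, fun y => ?_⟩
    simp [h₁, hx₂]
    ring
  by_cases hx₁ : r x₁ = 0
  · refine ⟨((b • S₂) ∘ₗ LinearMap.snd K V V).prod (S₂ ∘ₗ LinearMap.fst K V V), fun y => ?_⟩
    simp [h₂, hx₁, QuadraticMap.map_smul]
    ring
  -- U is a similarity of factor r(x₁)r(x₂). The coefficients of U below are chosen so that the two
  -- polar terms in (y₁, U y₂) cancel, leaving (r(x₁) + b r(x₂))(r(y₁) + b r(y₂)).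
  set U := S₁ ∘ₗ S₂
  have hU : ∀ y, r (U y) = r x₁ * (r x₂ * r y) := fun y => by simp [U, h₁, h₂]
  refine ⟨(S₁ ∘ₗ (LinearMap.fst K V V - (b / r x₁) • (U ∘ₗ LinearMap.snd K V V))).prod
    (S₂ ∘ₗ (LinearMap.fst K V V + (r x₂)⁻¹ • (U ∘ₗ LinearMap.snd K V V))), fun y => ?_⟩
  simp only [LinearMap.prod_apply, Function.prod_apply, QuadraticMap.prod_apply,
    LinearMap.comp_apply, h₁,
    LinearMap.add_apply, LinearMap.smul_apply, LinearMap.fst_apply,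
    LinearMap.snd_apply, _root_.smul_apply, h₂, smul_eq_mul, sub_eq_add_neg, ← neg_smul,
    QuadraticMap.map_add r, QuadraticMap.polar_smul_right, QuadraticMap.map_smul, hU]
  field_simp
  ring

/-- An isotropic vector and a vector not orthogonal to it span a form representing everything. -/
theorem exists_eq_of_polar_ne_zero {Q : QuadraticForm K V} {x y : V} (hx : Q x = 0)
    (hxy : QuadraticMap.polar Q x y ≠ 0) (a : K) : ∃ z, Q z = a := by
  refine ⟨((a - Q y) / QuadraticMap.polar Q x y) • x + y, ?_⟩
  rw [QuadraticMap.map_add Q, QuadraticMap.map_smul, hx, QuadraticMap.polar_smul_left]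
  simp only [smul_eq_mul]
  field_simp
  ring

end Multiplicative

/-! ### Multiplicativity over all extensions, in diagonal coordinates. -/

section Weights

variable {F : Type u} [Field F]

/-- The diagonal form with weights `c` is multiplicative over all extension fields. -/
def UniversallyMultiplicative {ι : Type*} [Fintype ι] (c : ι → F) : Prop :=
  ∀ (K : Type u) [Field K] [Algebra F K],
    IsMultiplicative (QuadraticMap.weightedSumSquares K c : QuadraticForm K (ι → K))

variable {ι : Type*} [Fintype ι]

theorem UniversallyMultiplicative.reindex {κ : Type*} [Fintype κ] {c : ι → F}
    (h : UniversallyMultiplicative c) (e : κ ≃ ι) : UniversallyMultiplicative (c ∘ e) := by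
  intro K _ _
  refine (h K).of_equiv (LinearEquiv.funCongrLeft K K e.symm) fun x => ?_
  simp only [QuadraticMap.weightedSumSquares_apply, LinearEquiv.funCongrLeft_apply,
    LinearMap.funLeft_apply]
  rw [← e.sum_comp]
  simp

theorem UniversallyMultiplicative.binary_mul {c : ι → F} (h : UniversallyMultiplicative c)
    (b : F) : UniversallyMultiplicative fun p : Fin 2 × ι => ![1, b] p.1 * c p.2 := by
  intro K _ _
  refine ((h K).prod_smul (algebraMap F K b)).of_equiv
    ((LinearEquiv.curry K K (Fin 2) ι).trans (LinearEquiv.finTwoArrow K (ι → K))) fun x => ?_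
  simp only [QuadraticMap.prod_apply, _root_.smul_apply,
    QuadraticMap.weightedSumSquares_apply, Fintype.sum_prod_type, Fin.sum_univ_two]
  simp [Algebra.smul_def, Finset.mul_sum, mul_assoc]

theorem universallyMultiplicative_one : UniversallyMultiplicative fun _ : Unit => (1 : F) := by
  intro K _ _ x
  refine ⟨x () • LinearMap.id, fun y => ?_⟩
  simp [QuadraticMap.weightedSumSquares_apply]
  ring

/-- Each doubling is a product with ⟨1, 1⟩; this is why powers of two, and hence the factor 2 of the
upper bound, occur. -/
theorem UniversallyMultiplicative.copies_two_pow {c : ι → F} (h : UniversallyMultiplicative c)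
    (k : ℕ) : UniversallyMultiplicative fun p : Fin (2 ^ k) × ι => c p.2 := by
  induction k with
  | zero => exact h.reindex (Equiv.uniqueProd ι (Fin 1))
  | succ k ih =>
    have := (ih.binary_mul 1).reindex
      ((Equiv.prodCongr ((finCongr (pow_succ' 2 k)).trans finProdFinEquiv.symm)
        (Equiv.refl ι)).trans (Equiv.prodAssoc (Fin 2) (Fin (2 ^ k)) ι))
    have h1 : ∀ i : Fin 2, ![(1 : F), 1] i = 1 := by simp [Fin.forall_fin_two]
    simpa [Function.comp_def, h1] using this

end Weights

/-! ### Pfister forms have multiplicative orthogonal coordinates. -/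

section Pfister

variable {F : Type u} [Field F] [Invertible (2 : F)]

/-- Orthogonal coordinates in which a form is multiplicative over all extension fields. -/
def HasMultiplicativeBasis {V : Type*} [AddCommGroup V] [Module F V] (q : QuadraticForm F V) :
    Prop :=
  ∃ (ι : Type) (_ : Fintype ι) (v : Module.Basis ι F V),
    (QuadraticMap.associated q).IsOrthoᵢ v ∧ UniversallyMultiplicative fun i => q (v i)

theorem HasMultiplicativeBasis.of_equivalent {V : Type*} [AddCommGroup V] [Module F V]
    {V' : Type*} [AddCommGroup V'] [Module F V']
    {q : QuadraticForm F V} (h : HasMultiplicativeBasis q) {q' : QuadraticForm F V'}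
    (e : q'.Equivalent q) : HasMultiplicativeBasis q' := by
  obtain ⟨ι, _, v, hv, hm⟩ := h
  obtain ⟨e⟩ := e
  have he : ∀ x, q' (e.toLinearEquiv.symm x) = q x := fun x => by
    have := e.map_app (e.toLinearEquiv.symm x)
    rw [← this]
    congr 1
    exact e.toLinearEquiv.apply_symm_apply x
  refine ⟨ι, inferInstance, v.map e.toLinearEquiv.symm, ?_, ?_⟩
  · intro i j hij
    have := hv hij
    simp only [Function.onFun, QuadraticMap.associated_apply] at this ⊢
    simp only [Module.Basis.map_apply, ← map_add, he]
    exact this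
  · simpa only [Module.Basis.map_apply, he] using hm

theorem HasMultiplicativeBasis.binary_tmul {V : Type*} [AddCommGroup V] [Module F V]
    {q : QuadraticForm F V} (h : HasMultiplicativeBasis q) (a : Fˣ) :
    HasMultiplicativeBasis (QuadraticForm.tmul (binary a) q) := by
  obtain ⟨ι, _, v, hv, hm⟩ := h
  refine ⟨Fin 2 × ι, inferInstance, (Pi.basisFun F (Fin 2)).tensorProduct v, ?_, ?_⟩
  · rintro ⟨i, k⟩ ⟨j, l⟩ hij
    simp only [Function.onFun, QuadraticForm.associated_tmul,
      Module.Basis.tensorProduct_apply, LinearMap.BilinForm.tensorDistrib_tmul]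
    by_cases hkl : k = l
    · have hij' : i ≠ j := fun h0 => hij (by rw [h0, hkl])
      have : QuadraticMap.associated (binary a) (Pi.single i 1) (Pi.single j 1) = 0 := by
        simp only [QuadraticMap.associated_apply, binary, QuadraticMap.weightedSumSquares_apply,
          Fin.sum_univ_two]
        fin_cases i <;> fin_cases j <;> simp_all
      simp [this]
    · have : QuadraticMap.associated q (v k) (v l) = 0 := hv hkl
      simp [this]
  · convert hm.binary_mul a using 2 with p
    obtain ⟨i, k⟩ := p
    simp only [Module.Basis.tensorProduct_apply, QuadraticForm.tensorDistrib_tmul, smul_eq_mul,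
      Pi.basisFun_apply]
    rw [mul_comm]
    congr 1
    rw [binary, QuadraticMap.weightedSumSquares_apply, Fin.sum_univ_two]
    fin_cases i <;> simp

theorem hasMultiplicativeBasis_sq :
    HasMultiplicativeBasis (QuadraticMap.sq : QuadraticForm F F) := by
  refine ⟨Unit, inferInstance, Module.Basis.singleton Unit F, ?_, ?_⟩
  · intro i j hij
    exact absurd (Subsingleton.elim i j) hij
  · simpa using universallyMultiplicative_one (F := F)

theorem hasMultiplicativeBasis_pfister (l : List Fˣ) :
    HasMultiplicativeBasis (pfister l).form := by
  induction l with
  | nil => exact hasMultiplicativeBasis_sq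
  | cons a l ih => exact ih.binary_tmul a

theorem IsPfister.hasMultiplicativeBasis {V : Type*} [AddCommGroup V] [Module F V]
    {q : QuadraticForm F V} (h : IsPfister q) : HasMultiplicativeBasis q := by
  obtain ⟨l, hl⟩ := h
  exact (hasMultiplicativeBasis_pfister l).of_equivalent hl

end Pfister

/-! ### Isometric maps and subforms. -/

section Subform

variable {F : Type*} [Field F] [Invertible (2 : F)] {V : Type*} [AddCommGroup V] [Module F V]
  {W : Type*} [AddCommGroup W] [Module F W]

theorem polar_eq_two_mul_associated (Q : QuadraticForm F V) (x y : V) :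
    QuadraticMap.polar Q x y = 2 * QuadraticMap.associated Q x y := by
  rw [QuadraticMap.associated_apply, QuadraticMap.polar]
  simp [← mul_assoc]

/-- The multiple may be isotropic, but pairing x with its own k-th component gives 2q(xₖ), so a
radical vector vanishes. -/
theorem radical_copies {q : QuadraticForm F V} (hq : q.Anisotropic) (n : ℕ) :
    (copies n q).radical = ⊥ := by
  rw [eq_bot_iff]
  intro x hx
  rw [QuadraticMap.mem_radical_iff'] at hx
  rw [Submodule.mem_bot]
  funext k
  apply hq
  have h1 := hx.2 (Pi.single k (x k))
  have h2 := QuadraticMap.Ring.polar_pi (fun _ : Fin n => q) x (Pi.single k (x k))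
  rw [QuadraticMap.polar, h1, hx.1, sub_zero, sub_self, Finset.sum_eq_single k] at h2
  · rw [Pi.single_eq_same, QuadraticMap.polar_self, two_smul, ← two_mul] at h2
    exact (mul_eq_zero.1 h2.symm).resolve_left (Invertible.ne_zero 2)
  · intro i _ hi
    simp [Pi.single_eq_of_ne hi]
  · simp

/-- An anisotropic form mapping isometrically to a regular form is a subform of it. -/
theorem isSubform_of_isometric [Module.Finite F V] {p : QuadraticForm F W} (hp : p.Anisotropic)
    {Q : QuadraticForm F V} (hQ : Q.radical = ⊥) (j : W →ₗ[F] V) (hj : ∀ x, Q (j x) = p x) :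
    IsSubform p Q := by
  have hinj : Function.Injective j := by
    rw [injective_iff_map_eq_zero]
    intro x hx
    apply hp
    rw [← hj, hx, QuadraticMap.map_zero]
  set B : LinearMap.BilinForm F V := QuadraticMap.associated Q
  have hB : B.IsRefl := fun x y h => by rw [← h]; exact QuadraticMap.associated_isSymm F Q y x
  set U := B.orthogonal (LinearMap.range j)
  have hc : IsCompl (LinearMap.range j) U := by
    -- The image of j is anisotropic, so it meets its orthogonal space trivially and splits off.
    rw [LinearMap.BilinForm.isCompl_orthogonal_iff_disjoint hB, Submodule.disjoint_def]
    rintro _ ⟨x, rfl⟩ hx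
    have h0 : B (j x) (j x) = 0 := hx (j x) ⟨x, rfl⟩
    rw [QuadraticMap.associated_eq_self_apply, hj] at h0
    rw [hp x h0, map_zero]
  have hpol : ∀ x, ∀ y ∈ U, QuadraticMap.polar Q (j x) y = 0 := fun x y hy => by
    rw [polar_eq_two_mul_associated]
    have : B (j x) y = 0 := hy (j x) ⟨x, rfl⟩
    rw [this, mul_zero]
  set b := (Module.finBasis F U).equivFun
  set r : QuadraticForm F (Fin (Module.finrank F U) → F) :=
    Q.comp (U.subtype ∘ₗ b.symm.toLinearMap) with hr
  have hr' : ∀ x, r x = Q (b.symm x : V) := fun x => rfl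
  refine ⟨Module.finrank F U, r, ?_, ⟨QuadraticMap.IsometryEquiv.symm
    ⟨((LinearEquiv.ofInjective j hinj).prodCongr b.symm).trans (Submodule.prodEquivOfIsCompl _ _ hc), ?_⟩⟩⟩
  · rw [QuadraticMap.nondegenerate_iff_radical_eq_bot, eq_bot_iff]
    intro x hx
    rw [QuadraticMap.mem_radical_iff'] at hx
    -- A radical vector of the complement is also orthogonal to the image of j, hence lies in the
    -- radical of Q.
    have hmem : (b.symm x : V) ∈ Q.radical := by
      rw [QuadraticMap.mem_radical_iff']
      refine ⟨by rw [← hr', hx.1], fun z => ?_⟩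
      obtain ⟨_, ⟨y, rfl⟩, u, hu, rfl⟩ := Submodule.mem_sup.1
        (hc.sup_eq_top ▸ Submodule.mem_top : z ∈ LinearMap.range j ⊔ U)
      have h1 := hx.2 (b ⟨u, hu⟩)
      rw [hr', hr', map_add, LinearEquiv.symm_apply_apply, Submodule.coe_add] at h1
      rw [add_left_comm, QuadraticMap.map_add Q (j y), QuadraticMap.map_add Q (j y) u, h1,
        hpol _ _ hu, hpol _ _ (Submodule.add_mem _ (b.symm x).2 hu)]
    rw [hQ, Submodule.mem_bot] at hmem
    rw [Submodule.mem_bot]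
    simpa using hmem
  · rintro ⟨x, y⟩
    change Q (j x + b.symm y) = p x + r y
    rw [QuadraticMap.map_add Q, hpol _ _ (b.symm y).2, hj, hr', add_zero]

end Subform

/-! ### Level, length, and representation of -1. -/

section Level

theorem IsSubform.exists_isometric {F : Type*} [Field F] {V : Type*} [AddCommGroup V]
    [Module F V] {W : Type*} [AddCommGroup W] [Module F W] {p : QuadraticForm F W}
    {Q : QuadraticForm F V} (h : IsSubform p Q) : ∃ j : W →ₗ[F] V, ∀ x, Q (j x) = p x := by
  obtain ⟨m, r, -, ⟨e⟩⟩ := h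
  refine ⟨e.symm.toLinearEquiv.toLinearMap ∘ₗ LinearMap.inl F W (Fin m → F), fun x => ?_⟩
  change Q (e.symm (x, 0)) = p x
  rw [e.symm.map_app]
  simp

variable {K : Type*} [Field K] {M : Type*} [AddCommGroup M] [Module K M]

/-- If a multiple of a multiplicative form is isotropic then it represents `-1`. -/
theorem IsMultiplicative.exists_copies_eq_neg_one {Q : QuadraticForm K M} (h : IsMultiplicative Q)
    (hu : ∀ x, x ≠ 0 → Q x = 0 → ∀ a, ∃ z, Q z = a) {n : ℕ} {v : Fin n → M} (hv : v ≠ 0)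
    (hv0 : copies n Q v = 0) : ∃ w, copies n Q w = -1 := by
  obtain ⟨k, hk⟩ := Function.ne_iff.1 hv
  by_cases hk0 : Q (v k) = 0
  · obtain ⟨z, hz⟩ := hu _ hk hk0 (-1)
    exact ⟨Pi.single k z, by rw [QuadraticMap.pi_apply_single, hz]⟩
  obtain ⟨T, hT⟩ := h (v k)
  -- The terms other than the k-th sum to -Q(vₖ); T followed by scaling divides each of them by
  -- Q(vₖ).
  refine ⟨fun i => if i = k then 0 else (Q (v k))⁻¹ • T (v i), ?_⟩
  rw [QuadraticMap.pi_apply, ← Finset.add_sum_erase _ _ (Finset.mem_univ k)] at hv0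
  rw [QuadraticMap.pi_apply, ← Finset.add_sum_erase _ _ (Finset.mem_univ k)]
  have : ∀ i ∈ Finset.univ.erase k,
      Q (if i = k then 0 else (Q (v k))⁻¹ • T (v i)) = (Q (v k))⁻¹ * Q (v i) := by
    intro i hi
    rw [if_neg (Finset.ne_of_mem_erase hi), QuadraticMap.map_smul, hT, smul_eq_mul]
    field_simp
  rw [Finset.sum_congr rfl this, ← Finset.mul_sum, if_pos rfl, QuadraticMap.map_zero, zero_add,
    eq_neg_of_add_eq_zero_right hv0]
  field_simp

/-- When Q(y) ≠ 0, -1 = Q(x)/Q(y) is a quotient of values, hence a value; otherwise Q itself is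
isotropic and universal. -/
theorem IsMultiplicative.exists_eq_neg_one {Q : QuadraticForm K M} (h : IsMultiplicative Q)
    (hu : ∀ x, x ≠ 0 → Q x = 0 → ∀ a, ∃ z, Q z = a) {x y : M} (hxy : x ≠ 0 ∨ y ≠ 0)
    (hxy0 : Q x + Q y = 0) : ∃ z, Q z = -1 := by
  by_cases hy : Q y = 0
  · rw [hy, add_zero] at hxy0
    exact hxy.elim (fun h0 => hu x h0 hxy0 _) fun h0 => hu y h0 hy _
  obtain ⟨T, hT⟩ := h y
  refine ⟨(Q y)⁻¹ • T x, ?_⟩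
  rw [QuadraticMap.map_smul, hT, eq_neg_of_add_eq_zero_left hxy0, smul_eq_mul]
  field_simp

theorem level_le_of_exists {R : Type*} [CommRing R] {N : Type*} [AddCommGroup N] [Module R N]
    {Q : QuadraticForm R N} {n : ℕ} (hn : 0 < n) (h : ∃ v, copies n Q v = -1) : level Q ≤ n :=
  sInf_le ⟨n, rfl, hn, h⟩

theorem exists_of_level_ne_top {R : Type*} [CommRing R] {N : Type*} [AddCommGroup N] [Module R N]
    {Q : QuadraticForm R N} (h : level Q ≠ ⊤) :
    ∃ n : ℕ, level Q = n ∧ 0 < n ∧ ∃ v, copies n Q v = -1 := by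
  have hne : {N : ℕ∞ | ∃ n : ℕ, N = n ∧ 0 < n ∧ ∃ v, copies n Q v = -1}.Nonempty := by
    by_contra h0
    rw [Set.not_nonempty_iff_eq_empty] at h0
    exact h (by rw [level, h0, sInf_empty])
  exact csInf_mem hne

theorem exists_of_length_ne_top {F : Type*} [Field F] {V : Type*} [AddCommGroup V] [Module F V]
    {W : Type*} [AddCommGroup W] [Module F W] {q : QuadraticForm F V} {φ : QuadraticForm F W}
    (h : length q φ ≠ ⊤) : ∃ n : ℕ, length q φ = n ∧ IsSubform φ (copies n q) := by
  have hne : {N : ℕ∞ | ∃ n : ℕ, N = n ∧ IsSubform φ (copies n q)}.Nonempty := by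
    by_contra h0
    rw [Set.not_nonempty_iff_eq_empty] at h0
    exact h (by rw [length, h0, sInf_empty])
  exact csInf_mem hne

end Level

/-! ### Universality, hyperbolic forms, and diagonal coordinates of multiples. -/

section Coordinates

variable {F : Type u} [Field F] {ι : Type*} [Fintype ι]

/-- Nonzero weights make an isotropic vector pair nontrivially with a coordinate vector. -/
theorem exists_diag_eq_of_isotropic {K : Type*} [Field K] [Algebra F K] (h2 : (2 : K) ≠ 0)
    {c : ι → F} (hc : ∀ i, c i ≠ 0) {x : ι → K} (hx : x ≠ 0)
    (hx0 : QuadraticMap.weightedSumSquares K c x = 0) (a : K) :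
    ∃ z : ι → K, QuadraticMap.weightedSumSquares K c z = a := by
  classical
  obtain ⟨i, hi⟩ := Function.ne_iff.1 hx
  refine exists_eq_of_polar_ne_zero (y := Pi.single i 1) hx0 ?_ a
  have h1 : diag c x (Pi.single i 1) = c i • x i := by
    rw [diag, Finset.sum_eq_single i]
    · simp
    · intro j _ hj
      simp [Pi.single_eq_of_ne hj]
    · simp
  have : QuadraticMap.polar (QuadraticMap.weightedSumSquares K c) x (Pi.single i 1) =
      2 * c i • x i := by
    rw [QuadraticMap.polar]
    simp only [weightedSumSquares_eq_diag, diag_add_left, diag_add_right,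
      diag_comm c (Pi.single i 1) x, h1]
    ring
  rw [this]
  exact mul_ne_zero h2 (smul_ne_zero (hc i) hi)

/-- The hyperbolic form `P ⊥ -P` contains all diagonal forms of dimension at most `dim P`. -/
theorem exists_isometric_of_eq_neg_one [Invertible (2 : F)] {c : ι → F} (hc : ∀ i, c i ≠ 0)
    (hm : IsMultiplicative (QuadraticMap.weightedSumSquares F c : QuadraticForm F (ι → F)))
    (h1 : ∃ z : ι → F, QuadraticMap.weightedSumSquares F c z = -1) {m : ℕ}
    (hcard : m ≤ Fintype.card ι) (β : Fin m → F) :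
    ∃ j₁ j₂ : (Fin m → F) →ₗ[F] (ι → F), ∀ y,
      QuadraticMap.weightedSumSquares F c (j₁ y) + QuadraticMap.weightedSumSquares F c (j₂ y) =
        ∑ i, β i * y i ^ 2 := by
  classical
  obtain ⟨z, hz⟩ := h1
  obtain ⟨T, hT⟩ := hm z
  obtain ⟨ε⟩ : Nonempty (Fin m ↪ ι) := Function.Embedding.nonempty_of_card_le (by simpa)
  have h2 : (2 : F) ≠ 0 := Invertible.ne_zero 2
  set E : (Fin m → F) → (Fin m → F) →ₗ[F] (ι → F) := fun s =>
    ∑ i, (LinearMap.single F (fun _ : ι => F) (ε i)) ∘ₗ (s i • LinearMap.proj i) with hE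
  have hEq : ∀ s y, QuadraticMap.weightedSumSquares F c (E s y) =
      ∑ i, c (ε i) * (s i * y i) ^ 2 := by
    intro s y
    have happ : ∀ p, E s y p = ∑ i, if p = ε i then s i * y i else 0 := by
      intro p
      simp [hE, Pi.single_apply]
    rw [QuadraticMap.weightedSumSquares_apply]
    refine (Fintype.sum_of_injective ε ε.injective _ _ ?_ ?_).symm
    · intro p hp
      have : E s y p = 0 := by
        rw [happ]
        exact Finset.sum_eq_zero fun i _ => if_neg fun h0 => hp ⟨i, h0.symm⟩
      simp [this]
    · intro i
      have : E s y (ε i) = s i * y i := by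
        rw [happ, Finset.sum_eq_single i]
        · simp
        · intro k _ hk
          exact if_neg fun h0 => hk (ε.injective h0.symm)
        · simp
      rw [this, smul_eq_mul, sq]
  -- This is t = ((t + 1)/2)² - ((t - 1)/2)² with t = β/c; T, of factor -1, supplies the minus sign.
  refine ⟨E fun i => (β i / c (ε i) + 1) / 2, T ∘ₗ E fun i => (β i / c (ε i) - 1) / 2,
    fun y => ?_⟩
  rw [LinearMap.comp_apply, hT, hz, hEq, hEq, neg_one_mul, ← sub_eq_add_neg,
    ← Finset.sum_sub_distrib]
  refine Finset.sum_congr rfl fun i _ => ?_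
  have := hc (ε i)
  field_simp
  ring

/-- The coordinates of `n × Q` for a form with diagonal coordinates. -/
theorem exists_copies_equiv {K : Type*} [Field K] [Algebra F K] {M : Type*} [AddCommGroup M]
    [Module K M] {Q : QuadraticForm K M} {c : ι → F} (e : (ι → K) ≃ₗ[K] M)
    (he : ∀ x, Q (e x) = QuadraticMap.weightedSumSquares K c x) (n : ℕ) :
    ∃ E : (Fin n × ι → K) ≃ₗ[K] (Fin n → M), ∀ x,
      copies n Q (E x) = QuadraticMap.weightedSumSquares K (fun p : Fin n × ι => c p.2) x := by
  refine ⟨(LinearEquiv.curry K K (Fin n) ι).trans (LinearEquiv.piCongrRight fun _ => e),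
    fun x => ?_⟩
  simp [QuadraticMap.pi_apply, he, QuadraticMap.weightedSumSquares_apply, Fintype.sum_prod_type]

theorem exists_baseChange_equiv [Invertible (2 : F)] {K : Type*} [Field K] [Algebra F K]
    {V : Type*} [AddCommGroup V] [Module F V] {q : QuadraticForm F V} (v : Module.Basis ι F V)
    (hv : (QuadraticMap.associated q).IsOrthoᵢ v) :
    ∃ e : (ι → K) ≃ₗ[K] K ⊗[F] V, ∀ x,
      q.baseChange K (e x) = QuadraticMap.weightedSumSquares K (fun i => q (v i)) x := by
  refine ⟨(Algebra.TensorProduct.basis K v).equivFun.symm, fun x => ?_⟩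
  rw [weightedSumSquares_eq_diag, ← baseChange_sum_tmul_of_isOrtho q x hv,
    Module.Basis.equivFun_symm_apply]
  congr 1
  refine Finset.sum_congr rfl fun i _ => ?_
  rw [Algebra.TensorProduct.basis_apply, TensorProduct.smul_tmul', smul_eq_mul, mul_one]

end Coordinates

/-! ### The generic zero of φ over F(φ). -/

section Isotropy

variable {F : Type u} [Field F] [Invertible (2 : F)] {V : Type*} [AddCommGroup V] [Module F V]
  {W : Type*} [AddCommGroup W] [Module F W] [Module.Finite F W]

theorem not_poly_dvd_X {φ : QuadraticForm F W} (hφ : φ.Anisotropic)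
    (hdim : 2 ≤ Module.finrank F W) (i : Fin (Module.finrank F W)) :
    ¬ poly φ ∣ MvPolynomial.X i := by
  rintro ⟨g, hg⟩
  have h0 := (irreducible_poly hφ hdim).ne_zero
  have hg0 : g ≠ 0 := by
    rintro rfl
    exact MvPolynomial.X_ne_zero (R := F) i (by rw [hg, mul_zero])
  have h1 := congrArg MvPolynomial.totalDegree hg
  rw [MvPolynomial.totalDegree_X, MvPolynomial.totalDegree_mul_of_isDomain h0 hg0,
    (isHomogeneous_poly φ).totalDegree h0] at h1
  omega

/-- Over `F(φ)`, a form containing a multiple of `φ` is isotropic. -/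
theorem exists_isotropic_of_isometric {q : QuadraticForm F V} {φ : QuadraticForm F W}
    (hφ : φ.Anisotropic) (hdim : 2 ≤ Module.finrank F W) {a : F} (ha : a ≠ 0) {n : ℕ}
    (j : W →ₗ[F] Fin n → V) (hj : ∀ x, copies n q (j x) = a * φ x) :
    ∃ v : Fin n → FunctionField φ ⊗[F] V, v ≠ 0 ∧
      copies n (q.baseChange (FunctionField φ)) v = 0 := by
  have := isDomain_coordRing hφ hdim
  set b := Module.finBasis F W
  set K := FunctionField φ
  set ξ : Fin (Module.finrank F W) → K := fun i =>
    algebraMap (CoordRing φ) K (Ideal.Quotient.mk _ (MvPolynomial.X i)) with hξ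
  have hξp : ∀ p, MvPolynomial.aeval ξ p = algebraMap (CoordRing φ) K (Ideal.Quotient.mk _ p) := by
    intro p
    have : MvPolynomial.aeval ξ = (IsScalarTower.toAlgHom F (CoordRing φ) K).comp
        (Ideal.Quotient.mkₐ F (Ideal.span {poly φ})) :=
      MvPolynomial.algHom_ext fun i => by simp [hξ]
    rw [this]
    rfl
  have hw : φ.baseChange K (∑ i, ξ i ⊗ₜ[F] b i) = 0 := by
    rw [← aeval_poly, hξp, Ideal.Quotient.eq_zero_iff_mem.2 (Ideal.mem_span_singleton_self _),
      map_zero]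
  -- Polarising makes the identity bilinear over F, so that it survives extension of scalars.
  have hassoc : ∀ x y, ∑ k, QuadraticMap.associated q (j x k) (j y k) =
      a * QuadraticMap.associated φ x y := by
    intro x y
    have h1 := hj (x + y)
    have h2 := hj x
    have h3 := hj y
    simp only [QuadraticMap.pi_apply, map_add, Pi.add_apply] at h1 h2 h3
    refine mul_left_cancel₀ (Invertible.ne_zero (2 : F)) ?_
    rw [Finset.mul_sum, mul_left_comm, ← polar_eq_two_mul_associated]
    simp only [← polar_eq_two_mul_associated, QuadraticMap.polar, Finset.sum_sub_distrib, h1, h2,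
      h3]
    ring
  refine ⟨fun k => ∑ i, ξ i ⊗ₜ[F] j (b i) k, fun h0 => ?_, ?_⟩
  -- A left inverse of j, extended to K, would send a zero image back to the generic vector. Its
  -- coordinates are nonzero, since the quadratic `poly φ` divides no variable.
  · have hinj : LinearMap.ker j = ⊥ := by
      rw [LinearMap.ker_eq_bot']
      intro x hx
      have := hj x
      rw [hx, QuadraticMap.map_zero, eq_comm, mul_eq_zero] at this
      exact hφ _ (this.resolve_left ha)
    obtain ⟨r, hr⟩ := j.exists_leftInverse_of_injective hinj
    have h1 : ∑ i, ξ i ⊗ₜ[F] b i = 0 := by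
      have h2 : ∀ i, b i = ∑ k, r (Pi.single k (j (b i) k)) := by
        intro i
        rw [← map_sum, Finset.univ_sum_single]
        exact (DFunLike.congr_fun hr (b i)).symm
      have h3 : ∀ k, ∑ i, ξ i ⊗ₜ[F] r (Pi.single k (j (b i) k)) = 0 := by
        intro k
        have h4 := congrArg
          ((r ∘ₗ LinearMap.single F (fun _ : Fin n => V) k).baseChange K) (congrFun h0 k)
        simpa [map_sum] using h4
      calc ∑ i, ξ i ⊗ₜ[F] b i = ∑ i, ∑ k, ξ i ⊗ₜ[F] r (Pi.single k (j (b i) k)) := by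
            refine Finset.sum_congr rfl fun i _ => ?_
            rw [← TensorProduct.tmul_sum, ← h2]
        _ = 0 := by
            rw [Finset.sum_comm]
            exact Finset.sum_eq_zero fun k _ => h3 k
    have h5 : ∀ i, ξ i = 0 := by
      refine Fintype.linearIndependent_iff.1 (Algebra.TensorProduct.basis K b).linearIndependent ξ ?_
      simpa [Algebra.TensorProduct.basis_apply, TensorProduct.smul_tmul'] using h1
    have h6 := h5 ⟨0, by omega⟩
    rw [hξ] at h6
    have h7 := (map_eq_zero_iff _ (IsFractionRing.injective (CoordRing φ) K)).1 h6
    rw [Ideal.Quotient.eq_zero_iff_mem, Ideal.mem_span_singleton] at h7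
    exact not_poly_dvd_X hφ hdim _ h7
  · rw [QuadraticMap.pi_apply]
    simp only [baseChange_sum_tmul]
    rw [baseChange_sum_tmul] at hw
    rw [Finset.sum_comm, ← mul_zero (algebraMap F K a), ← hw, Finset.mul_sum]
    refine Finset.sum_congr rfl fun i _ => ?_
    rw [Finset.sum_comm, Finset.mul_sum]
    refine Finset.sum_congr rfl fun l _ => ?_
    rw [← Finset.sum_mul, ← map_sum, hassoc, map_mul, mul_assoc]

end Isotropy

/-! ### Padding multiples of a form by zeros. -/

section Copies

variable {K : Type*} [Field K] {M : Type*} [AddCommGroup M] [Module K M]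

theorem exists_copies_of_le (Q : QuadraticForm K M) {n N : ℕ} (h : n ≤ N) (w : Fin n → M) :
    ∃ w' : Fin N → M, copies N Q w' = copies n Q w ∧ (w ≠ 0 → w' ≠ 0) := by
  have hcast : ∀ i : Fin n, (fun i : Fin N => if hi : i.1 < n then w ⟨i, hi⟩ else 0)
      (Fin.castLE h i) = w i := fun i => by simp
  refine ⟨fun i => if hi : i.1 < n then w ⟨i, hi⟩ else 0, ?_, fun hw h0 => hw ?_⟩
  · rw [QuadraticMap.pi_apply, QuadraticMap.pi_apply]
    refine (Fintype.sum_of_injective (Fin.castLE h) (Fin.castLE_injective h) _ _ ?_ ?_).symm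
    · intro i hi
      have : ¬ i.1 < n := fun hlt => hi ⟨⟨i, hlt⟩, rfl⟩
      simp [this]
    · intro i
      simp
  · funext i
    rw [← hcast, h0]
    rfl

theorem IsMultiplicative.exists_eq_one {Q : QuadraticForm K M} (h : IsMultiplicative Q) {x : M}
    (hx : Q x ≠ 0) : ∃ z, Q z = 1 := by
  obtain ⟨T, hT⟩ := h x
  refine ⟨(Q x)⁻¹ • T x, ?_⟩
  rw [QuadraticMap.map_smul, hT, smul_eq_mul]
  field_simp

/-- If `n × Q` represents `-1` for a multiplicative form `Q`, then `N × Q` is isotropic for all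
`N > n`. -/
theorem IsMultiplicative.exists_isotropic_copies {Q : QuadraticForm K M} (h : IsMultiplicative Q)
    {n N : ℕ} (hn : n < N) {w : Fin n → M} (hw : copies n Q w = -1) :
    ∃ v : Fin N → M, v ≠ 0 ∧ copies N Q v = 0 := by
  obtain ⟨i, hi⟩ : ∃ i, Q (w i) ≠ 0 := by
    by_contra! h0
    rw [QuadraticMap.pi_apply, Finset.sum_eq_zero fun i _ => h0 i] at hw
    simp at hw
  obtain ⟨z, hz⟩ := h.exists_eq_one hi
  obtain ⟨v, hv, hv0⟩ := exists_copies_of_le Q (n := n + 1) (N := N) hn (Fin.cons z w)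
  refine ⟨v, hv0 fun h0 => ?_, ?_⟩
  · have : z = 0 := congrFun h0 0
    rw [this, QuadraticMap.map_zero] at hz
    exact zero_ne_one hz
  · rw [QuadraticMap.pi_apply] at hw
    rw [hv, QuadraticMap.pi_apply, Fin.sum_univ_succ]
    simp [hz, hw]

end Copies

/-! ### Joining two blocks of copies. -/

section Append

variable {F : Type*} [Field F] {V : Type*} [AddCommGroup V] [Module F V]

/-- The orthogonal sum of `P` with itself, embedded in the sum of copies. -/
def appendLinear (n : ℕ) :
    ((Fin n → V) × (Fin n → V)) →ₗ[F] (Fin (n + n) → V) where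
  toFun p := Fin.append p.1 p.2
  map_add' p p' := by
    funext i
    refine Fin.addCases (fun i => ?_) (fun i => ?_) i <;> simp [-Fin.natAdd_eq_addNat]
  map_smul' r p := by
    funext i
    refine Fin.addCases (fun i => ?_) (fun i => ?_) i <;> simp [-Fin.natAdd_eq_addNat]

theorem copies_appendLinear (q : QuadraticForm F V) (n : ℕ) (p : (Fin n → V) × (Fin n → V)) :
    copies (n + n) q (appendLinear (F := F) n p) = copies n q p.1 + copies n q p.2 := by
  simp [QuadraticMap.pi_apply, appendLinear, Fin.sum_univ_add, -Fin.natAdd_eq_addNat]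

end Append

/-! ### The two cases of the upper bound, and the final estimate. -/

section Main

variable {F : Type u} [Field F] [Invertible (2 : F)] {V : Type*} [AddCommGroup V] [Module F V]
  {W : Type*} [AddCommGroup W] [Module F W]

/-- If `2 × (2 ^ k × q)` is isotropic then `2 ^ k × q` represents `-1`, and `2 × (2 ^ k × q)`
contains all forms of dimension at most that of `2 ^ k × q`. -/
theorem exists_isometric_of_isotropic [Module.Finite F V] [Module.Finite F W]
    {ι : Type*} [Fintype ι] {q : QuadraticForm F V} (hq : q.Anisotropic) (v : Module.Basis ι F V)
    (hv : (QuadraticMap.associated q).IsOrthoᵢ v)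
    (hm : UniversallyMultiplicative fun i => q (v i)) {k : ℕ} {x : Fin (2 ^ k + 2 ^ k) → V}
    (hx : x ≠ 0) (hx0 : copies (2 ^ k + 2 ^ k) q x = 0) (ψ : QuadraticForm F W)
    (hdim : (Module.finrank F W : ℕ∞) ≤ level q * (Module.finrank F V : ℕ∞)) :
    ∃ j : W →ₗ[F] (Fin (2 ^ k + 2 ^ k) → V), ∀ y, copies (2 ^ k + 2 ^ k) q (j y) = ψ y := by
  have hc : ∀ i, q (v i) ≠ 0 := fun i h0 => v.ne_zero i (hq _ h0)
  obtain ⟨E, hE⟩ := exists_copies_equiv (K := F) (Q := q) (c := fun i => q (v i)) v.equivFun.symm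
    (fun x => by
      rw [Module.Basis.equivFun_symm_apply, ← QuadraticMap.basisRepr_apply,
        QuadraticMap.basisRepr_eq_of_iIsOrtho q v hv]) (2 ^ k)
  have hP := hm.copies_two_pow k F
  have hPu : ∀ x, x ≠ 0 → QuadraticMap.weightedSumSquares F
      (fun p : Fin (2 ^ k) × ι => q (v p.2)) x = 0 → ∀ a, ∃ z, QuadraticMap.weightedSumSquares F
        (fun p : Fin (2 ^ k) × ι => q (v p.2)) z = a := fun x hx hx0 =>
    exists_diag_eq_of_isotropic (Invertible.ne_zero 2) (fun p => hc p.2) hx hx0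
  obtain ⟨z, hz⟩ := hP.exists_eq_neg_one hPu
    (x := E.symm fun i => x (Fin.castAdd _ i)) (y := E.symm fun i => x (Fin.natAdd _ i))
    (by
      by_contra! h0
      obtain ⟨h1, h2⟩ := h0
      rw [LinearEquiv.map_eq_zero_iff] at h1 h2
      refine hx (funext fun i => ?_)
      exact Fin.addCases (fun i => congrFun h1 i) (fun i => congrFun h2 i) i)
    (by
      rw [← hE, ← hE, LinearEquiv.apply_symm_apply, LinearEquiv.apply_symm_apply, ← hx0]
      simp [QuadraticMap.pi_apply, Fin.sum_univ_add])
  have hlevel : level q ≤ (2 ^ k : ℕ) :=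
    level_le_of_exists (by positivity) ⟨E z, by rw [hE, hz]⟩
  -- The dimension hypothesis enters here, through the bound 2^k on the level of q over F.
  have hcard : Module.finrank F W ≤ Fintype.card (Fin (2 ^ k) × ι) := by
    have h1 := hdim.trans (mul_le_mul_left hlevel _)
    rw [Fintype.card_prod, Fintype.card_fin, ← Module.finrank_eq_card_basis v]
    exact_mod_cast h1
  obtain ⟨w, hw⟩ := LinearMap.BilinForm.exists_orthogonal_basis
    (⟨QuadraticMap.associated_isSymm F ψ⟩ :
      (QuadraticMap.associated ψ : LinearMap.BilinForm F W).IsSymm)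
  obtain ⟨j₁, j₂, hj⟩ := exists_isometric_of_eq_neg_one (fun p : Fin (2 ^ k) × ι => hc p.2) hP
    ⟨z, hz⟩ hcard fun i => ψ (w i)
  refine ⟨appendLinear (2 ^ k) ∘ₗ (E.toLinearMap.prodMap E.toLinearMap) ∘ₗ (j₁.prod j₂) ∘ₗ
    w.equivFun.toLinearMap, fun y => ?_⟩
  have e1 := hj (w.equivFun y)
  have e2 := DFunLike.congr_fun (QuadraticMap.basisRepr_eq_of_iIsOrtho ψ w hw) (w.equivFun y)
  rw [QuadraticMap.basisRepr_apply, w.sum_equivFun] at e2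
  rw [e2, LinearMap.comp_apply, copies_appendLinear]
  change copies _ q (E (j₁ _)) + copies _ q (E (j₂ _)) = _
  rw [hE, hE, QuadraticMap.weightedSumSquares_apply (fun i => ψ (w i))]
  refine e1.trans (Finset.sum_congr rfl fun i _ => ?_)
  rw [sq, smul_eq_mul]

theorem length_le_of_isometric [Module.Finite F V] {q : QuadraticForm F V} (hq : q.Anisotropic)
    {ψ : QuadraticForm F W} (hψ : ψ.Anisotropic) {n : ℕ} (j : W →ₗ[F] (Fin n → V))
    (hj : ∀ y, copies n q (j y) = ψ y) : length q ψ ≤ n :=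
  sInf_le ⟨n, rfl, isSubform_of_isometric hψ (radical_copies hq n) j hj⟩

theorem level_length_bounds [Module.Finite F V] [Module.Finite F W]
    (q : QuadraticForm F V) (hq : q.Anisotropic) (hqP : IsPfister q)
    (φ : QuadraticForm F W) (hφ : φ.Anisotropic) (hφ2 : 2 ≤ Module.finrank F W)
    (hdim : (Module.finrank F W : ℕ∞) ≤ level q * (Module.finrank F V : ℕ∞))
    (a : F) (ha : a ∈ values φ) :
    level (q.baseChange (FunctionField φ)) ≤ length q (a • φ) ∧
      length q (a • φ) ≤ 2 * level (q.baseChange (FunctionField φ)) := by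
  have := isDomain_coordRing hφ hφ2
  have ha0 : a ≠ 0 := ha.1
  obtain ⟨ι, _, v, hv, hm⟩ := hqP.hasMultiplicativeBasis
  have hc : ∀ i, q (v i) ≠ 0 := fun i h0 => v.ne_zero i (hq _ h0)
  have h2 : (2 : FunctionField φ) ≠ 0 := by
    rw [← map_ofNat (algebraMap F (FunctionField φ))]
    exact (map_ne_zero_iff _ (algebraMap F (FunctionField φ)).injective).2
      (Invertible.ne_zero 2)
  obtain ⟨e, he⟩ := exists_baseChange_equiv (K := FunctionField φ) v hv
  have hK : IsMultiplicative (q.baseChange (FunctionField φ)) :=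
    (hm (FunctionField φ)).of_equiv e.symm fun x => by
      rw [← he, LinearEquiv.apply_symm_apply]
  have hKu : ∀ x, x ≠ 0 → q.baseChange (FunctionField φ) x = 0 →
      ∀ b, ∃ z, q.baseChange (FunctionField φ) z = b := by
    intro x hx hx0 b
    obtain ⟨z, hz⟩ := exists_diag_eq_of_isotropic h2 hc (x := e.symm x) (by simpa using hx)
      (by rw [← he, LinearEquiv.apply_symm_apply, hx0]) b
    exact ⟨e z, by rw [he, hz]⟩
  have haφ : (a • φ).Anisotropic := fun x hx => by
    rw [_root_.smul_apply, smul_eq_mul, mul_eq_zero] at hx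
    exact hφ x (hx.resolve_left ha0)
  constructor
  · by_cases ht : length q (a • φ) = ⊤
    · rw [ht]
      exact le_top
    obtain ⟨n, hn, hsub⟩ := exists_of_length_ne_top ht
    rw [hn]
    obtain ⟨j, hj⟩ := hsub.exists_isometric
    obtain ⟨w, hw, hw0⟩ := exists_isotropic_of_isometric hφ hφ2 ha0 j hj
    refine level_le_of_exists ?_ (hK.exists_copies_eq_neg_one hKu hw hw0)
    -- The level ranges over positive integers; n = 0 is impossible because w is a nonzero vector.
    rcases Nat.eq_zero_or_pos n with rfl | h
    · exact absurd (Subsingleton.elim w 0) hw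
    · exact h
  · by_cases ht : level (q.baseChange (FunctionField φ)) = ⊤
    · rw [ht, ENat.mul_top (by norm_num)]
      exact le_top
    obtain ⟨m, hm', hpos, w, hw⟩ := exists_of_level_ne_top ht
    rw [hm']
    set k := Nat.log 2 m
    have hk1 : 2 ^ k ≤ m := Nat.pow_log_le_self 2 hpos.ne'
    have hk2 : m < 2 ^ (k + 1) := Nat.lt_pow_succ_log_self one_lt_two m
    have hN : 2 ^ (k + 1) = 2 ^ k + 2 ^ k := by ring
    suffices ∃ j : W →ₗ[F] (Fin (2 ^ k + 2 ^ k) → V),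
        ∀ y, copies (2 ^ k + 2 ^ k) q (j y) = (a • φ) y by
      obtain ⟨j, hj⟩ := this
      refine (length_le_of_isometric hq haφ j hj).trans ?_
      have : 2 ^ k + 2 ^ k ≤ 2 * m := by omega
      exact_mod_cast this
    have hmN := hm.copies_two_pow (k + 1)
    rw [hN] at hmN hk2
    obtain ⟨E, hE⟩ := exists_copies_equiv (K := F) (Q := q) (c := fun i => q (v i))
      v.equivFun.symm (fun x => by
        rw [Module.Basis.equivFun_symm_apply, ← QuadraticMap.basisRepr_apply,
          QuadraticMap.basisRepr_eq_of_iIsOrtho q v hv]) (2 ^ k + 2 ^ k)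
    -- In both cases aφ is mapped isometrically into 2^(k+1)×q: through F(φ) if this multiple is
    -- anisotropic, through hyperbolicity if it is not.
    by_cases hQ : AnisotropicOn F (fun p : Fin (2 ^ k + 2 ^ k) × ι => q (v p.2)) ∅
    · obtain ⟨E', hE'⟩ := exists_copies_equiv e he (2 ^ k + 2 ^ k)
      obtain ⟨x, hx, hx0⟩ := hK.exists_isotropic_copies hk2 hw
      obtain ⟨j, hj⟩ := exists_isometric_of_isotropic_functionField hφ hφ2 hQ
        (fun K _ _ x => by simpa only [weightedSumSquares_eq_diag] using hmN K x)
        (x := E'.symm x) (by simpa using hx)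
        (by rw [← weightedSumSquares_eq_diag, ← hE', LinearEquiv.apply_symm_apply, hx0]) ha
      refine ⟨E.toLinearMap ∘ₗ j, fun y => ?_⟩
      rw [LinearMap.comp_apply, LinearEquiv.coe_coe, hE, weightedSumSquares_eq_diag, hj,
        _root_.smul_apply, smul_eq_mul]
    · simp only [AnisotropicOn, not_forall] at hQ
      obtain ⟨x, -, hx0, hx⟩ := hQ
      exact exists_isometric_of_isotropic hq v hv hm (x := E x) (by simpa using hx)
        (by rw [hE, weightedSumSquares_eq_diag, hx0]) (a • φ) hdim

end Main

end QForm

end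

theorem mainTheorem11 {F : Type*} [Field F] [Invertible (2 : F)]
    {V : Type*} [AddCommGroup V] [Module F V] [Module.Finite F V]
    {W : Type*} [AddCommGroup W] [Module F W] [Module.Finite F W]
    (q : QuadraticForm F V) (hq : q.Anisotropic) (hqP : QForm.IsPfister q)
    (φ : QuadraticForm F W) (hφ : φ.Anisotropic) (hφ2 : 2 ≤ Module.finrank F W)
    (hdim : (Module.finrank F W : ℕ∞) ≤ QForm.level q * (Module.finrank F V : ℕ∞))
    (a : F) (ha : a ∈ QForm.values φ) :
    QForm.level (q.baseChange (QForm.FunctionField φ)) ≤ QForm.length q (a • φ) ∧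
      QForm.length q (a • φ) ≤ 2 * QForm.level (q.baseChange (QForm.FunctionField φ)) := by
  exact QForm.level_length_bounds q hq hqP φ hφ hφ2 hdim a ha
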